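/- Let $\Bbbk$ be a field of characteristic $0$, let $\mathbb Z_+=\{0,1,2,\dots\}$, let $(X,\le)$ be a well-ordered set, and let $N:X\times X\to\mathbb Z_+$ be an arbitrary function. Write $x^{(s)}=\frac1{s!}x^s$. **The free conformal algebra.** An associative conformal algebra is a $\Bbbk$-space $C$ with a linear map $\partial$ and bilinear products $(\cdot\,{}_{(n)}\,\cdot)$, $n\in\mathbb Z_+$, such that for all $a,b,c\in C$ and $n,m\in\mathbb Z_+$: $a_{(n)}b=0$ for almost all $n$; $\partial a_{(n)}b=-n\,a_{(n-1)}b$; $a_{(n)}\partial b=\partial(a_{(n)}b)+n\,a_{(n-1)}b$; and $a_{(n)}(b_{(m)}c)=\sum_{s\ge0}\binom ns(a_{(n-s)}b)_{(m+s)}c$. Let $\mathrm{Conf}(X,N)$ be the free associative conformal algebra generated by $X$ subject to $a_{(n)}b=0$ for $a,b\in X$, $n\ge N(a,b)$. For $S\subset \mathrm{Conf}(X,N)$ let $\mathrm{Conf}(X,N\mid S)$ be the quotient of $\mathrm{Conf}(X,N)$ by the (two-sided, $\partial$-invariant) ideal generated by $S$. **Words and order.** Let $O=\{\partial,L_n^a,R_n^a\mid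 n\in\mathbb Z_+,a\in X\}$ and $Z=O\,\dot\cup\,X$. Order words in $O$ first by their degree in the variables $R_n^a$, then by deg-lex, where $\partial<L_n^a<R_m^b$, and $L_n^a<L_m^b$ iff $n<m$ or $n=m$, $a<b$, and similarly for the $R_n^a$. Order words $ux$ ($u$ a possibly empty word in $O$, $x\in X$) by $ux\prec vy$ iff $u\prec v$, or $u=v$ and $x<y$; and let words in $O$ precede words $ux$. This is extended to a monomial order $\prec$ on all words in $Z$ by comparing first the number of letters from $X$, then the number of letters $R_n^a$, then the length, and then lexicographically with $O<X$. For nonzero $f\in\Bbbk\langle Z\rangle$ let $\bar f$ be its principal monomial; $f$ is monic if $\bar f$ has coefficient $1$. A set $T\subset\Bbbk\langle Z\rangle$ of monic polynomials is a Gröbner–Shirshov basis if all compositions of elements $f,g\in T$ are trivial: compositions are $f-ugv$ with $w=\bar f=u\bar gv$ ($u,v$ possibly empty), and $fv_2-u_1g$ with $\bar f=u_1u_2$, $\bar g=u_2v_2$, $w=u_1u_2v_2$ ($u_1,u_2,v_2$ nonempty); a composition is trivial if it equals $\sum_i\alpha_iu_is_iv_i$ with $\alpha_i\in\Bbbk$,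 $s_i\in T$, words $u_i,v_i$, and $u_i\bar s_iv_i\prec w$. Let $A(X)$ be the associative algebra generated by $O$ with the defining relations $\Sigma$: $$L_n^a\partial-\partial L_n^a-nL_{n-1}^a,\qquad R_n^a\partial-\partial R_n^a-nR_{n-1}^a,\qquad R_m^bL_n^a-L_n^aR_m^b\qquad(a,b\in X,\ n,m\in\mathbb Z_+),$$ and let $F(X)$ be the free left $A(X)$-module generated by $X$. A set $T$ of monic linear combinations of words $ux$ is a Gröbner–Shirshov basis in $F(X)$ if $T\cup\Sigma\cup\{xa,xy\mid x,y\in X,\ a\in O\}$ is a Gröbner–Shirshov basis in $\Bbbk\langle Z\rangle$. A normal word is a word $\partial^sL_{n_1}^{a_1}\cdots L_{n_k}^{a_k}c$ with $s,k\ge0$, $a_i,c\in X$, $0\le n_i<N(a_i,a_{i+1})$ for $i<k$, and $0\le n_k<N(a_k,c)$; it represents the element $\partial^s(a_1\,{}_{(n_1)}(a_2\,{}_{(n_2)}\cdots(a_k\,{}_{(n_k)}c)\cdots))$ of $\mathrm{Conf}(X,N)$. Let $\Sigma(X,N)$ consist of $$L_n^ab\quad(a,b\in X,\ n\ge N(a,b)),$$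 $$R_n^ba-\sum_{s=0}^{N(a,b)-n-1}(-1)^{n+s}\partial^{(s)}L_{n+s}^ab\quad(a,b\in X,\ n\in\mathbb Z_+),$$ $$L_n^aL_m^bu+\sum_{q\ge1}(-1)^q\binom nqL_{n-q}^aL_{m+q}^bu\quad(a,b\in X,\ n\ge N(a,b),\ m\in\mathbb Z_+,\ u\text{ a normal word without }\partial).$$ **Theorem.** Let $S\subset\mathrm{Conf}(X,N)$. Identify $S$ with the set of linear combinations of normal words in $\Bbbk\langle Z\rangle$ that represent its elements, and suppose that these are monic. Then the following are equivalent: 1. $S$ is a Gröbner–Shirshov basis in $\mathrm{Conf}(X,N)$, that is, $S\cup\Sigma(X,N)$ is a Gröbner–Shirshov basis in $F(X)$; 2. the $S$-reduced normal words, i.e. the normal words that are not of the form $u\bar sv$ with $s\in S$ and words $u,v$, form a linear basis of $\mathrm{Conf}(X,N\mid S)$. -/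

import Mathlib

namespace ConfAlg

universe u v w

/-! ### Associative conformal algebras, ideals, quotients -/

/-- The operations of a conformal algebra: a linear map `∂` and bilinear products indexed by
`n = 0, 1, 2, …`. -/
class ConformalOps (k : Type v) (C : Type w) [Field k] [AddCommGroup C] [Module k C] where
  dMap : C →ₗ[k] C
  nMul : ℕ → C →ₗ[k] C →ₗ[k] C

section Ops

variable (k : Type v) {C : Type w} [Field k] [AddCommGroup C] [Module k C] [ConformalOps k C]

/-- The operation `∂`. -/
def D : C →ₗ[k] C := ConformalOps.dMap

/-- The product `a (n) b`. -/
def mul (n : ℕ) : C →ₗ[k] C →ₗ[k] C := ConformalOps.nMul n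

end Ops

/-- Associative conformal algebras. In `D_mul` and `mul_D` the terms with `n - 1` have coefficient
zero for `n = 0`. -/
class IsAssocConformal (k : Type v) (C : Type w) [Field k] [AddCommGroup C] [Module k C]
    [ConformalOps k C] : Prop where
  locality : ∀ a b : C, ∃ M : ℕ, ∀ n, M ≤ n → mul k n a b = 0
  D_mul : ∀ (n : ℕ) (a b : C), mul k n (D k a) b = -(n • mul k (n - 1) a b)
  mul_D : ∀ (n : ℕ) (a b : C), mul k n a (D k b) = D k (mul k n a b) + n • mul k (n - 1) a b
  assoc : ∀ (n m : ℕ) (a b c : C), mul k n a (mul k m b c) =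
    ∑ s ∈ Finset.range (n + 1), n.choose s • mul k (m + s) (mul k (n - s) a b) c

section Ideals

variable (k : Type v) {C : Type w} [Field k] [AddCommGroup C] [Module k C] [ConformalOps k C]

/-- Two-sided conformal ideals: subspaces closed under `∂` and under multiplication by
arbitrary elements on both sides. -/
structure IsIdeal (I : Submodule k C) : Prop where
  D_mem : ∀ a ∈ I, D k a ∈ I
  mul_mem_left : ∀ (n : ℕ) (a b : C), b ∈ I → mul k n a b ∈ I
  mul_mem_right : ∀ (n : ℕ) (a b : C), a ∈ I → mul k n a b ∈ I

/-- The ideal generated by a set. -/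
def ideal (S : Set C) : Submodule k C := sInf {I | IsIdeal k I ∧ S ⊆ I}

theorem subset_ideal (S : Set C) : S ⊆ ideal k S := fun _ hx =>
  Submodule.mem_sInf.2 fun _ hI => hI.2 hx

theorem ideal_le {S : Set C} {I : Submodule k C} (hI : IsIdeal k I) (hS : S ⊆ I) :
    ideal k S ≤ I := sInf_le ⟨hI, hS⟩

theorem isIdeal_ideal (S : Set C) : IsIdeal k (ideal k S) where
  D_mem a ha := Submodule.mem_sInf.2 fun I hI => hI.1.D_mem a (Submodule.mem_sInf.1 ha I hI)
  mul_mem_left n a b hb := Submodule.mem_sInf.2 fun I hI =>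
    hI.1.mul_mem_left n a b (Submodule.mem_sInf.1 hb I hI)
  mul_mem_right n a b ha := Submodule.mem_sInf.2 fun I hI =>
    hI.1.mul_mem_right n a b (Submodule.mem_sInf.1 ha I hI)

/-- The quotient by the ideal generated by `S`. -/
abbrev IdealQuotient (S : Set C) : Type w := C ⧸ ideal k S

/-- The induced operations on the quotient by an ideal. -/
instance quotientOps (S : Set C) : ConformalOps k (IdealQuotient k S) where
  dMap := (ideal k S).mapQ (ideal k S) (D k) fun a ha => (isIdeal_ideal k S).D_mem a ha
  nMul n := (ideal k S).liftQ
    ((ideal k S).liftQ (((mul k n).compr₂ (ideal k S).mkQ).flip) (by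
      intro b hb
      ext a
      simpa using (isIdeal_ideal k S).mul_mem_left n a b hb)).flip (by
      intro a ha
      ext b
      exact (Submodule.Quotient.mk_eq_zero _).2 ((isIdeal_ideal k S).mul_mem_right n a b ha))

theorem D_mk (S : Set C) (a : C) :
    D k ((ideal k S).mkQ a) = (ideal k S).mkQ (D k a) := rfl

theorem mul_mk (S : Set C) (n : ℕ) (a b : C) :
    mul k n ((ideal k S).mkQ a) ((ideal k S).mkQ b) = (ideal k S).mkQ (mul k n a b) := rfl

/-- A quotient of an associative conformal algebra is an associative conformal algebra. -/
instance quotient_isAssocConformal [IsAssocConformal k C] (S : Set C) :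
    IsAssocConformal k (IdealQuotient k S) where
  locality a b := by
    obtain ⟨a, rfl⟩ := (ideal k S).mkQ_surjective a
    obtain ⟨b, rfl⟩ := (ideal k S).mkQ_surjective b
    obtain ⟨M, hM⟩ := IsAssocConformal.locality (k := k) a b
    exact ⟨M, fun n hn => by rw [mul_mk, hM n hn, map_zero]⟩
  D_mul n a b := by
    obtain ⟨a, rfl⟩ := (ideal k S).mkQ_surjective a
    obtain ⟨b, rfl⟩ := (ideal k S).mkQ_surjective b
    simp only [D_mk, mul_mk, IsAssocConformal.D_mul, map_neg, map_nsmul]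
  mul_D n a b := by
    obtain ⟨a, rfl⟩ := (ideal k S).mkQ_surjective a
    obtain ⟨b, rfl⟩ := (ideal k S).mkQ_surjective b
    simp only [D_mk, mul_mk, IsAssocConformal.mul_D, map_add, map_nsmul]
  assoc n m a b c := by
    obtain ⟨a, rfl⟩ := (ideal k S).mkQ_surjective a
    obtain ⟨b, rfl⟩ := (ideal k S).mkQ_surjective b
    obtain ⟨c, rfl⟩ := (ideal k S).mkQ_surjective c
    simp only [mul_mk, IsAssocConformal.assoc, map_sum, map_nsmul]

end Ideals

/-! ### The free associative conformal algebra with a given locality function on generators -/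

/-- Formal expressions in the generators, the unary symbol `∂` and the binary symbols `(n)`. -/
inductive Term (X : Type u) : Type u
  | of : X → Term X
  | d : Term X → Term X
  | mul : ℕ → Term X → Term X → Term X

/-- The free (nonassociative) algebra with operations `∂` and `(n)`. -/
abbrev TermAlg (k : Type v) [Field k] (X : Type u) : Type (max u v) := Term X →₀ k

section Free

variable (k : Type v) [Field k] {X : Type u}

noncomputable instance termOps : ConformalOps k (TermAlg k X) where
  dMap := Finsupp.lmapDomain k k Term.d
  nMul n := Finsupp.linearCombination k fun t => Finsupp.lmapDomain k k (Term.mul n t)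

theorem D_single (t : Term X) (c : k) :
    D k (Finsupp.single t c : TermAlg k X) = Finsupp.single (Term.d t) c :=
  Finsupp.mapDomain_single

theorem mul_single (n : ℕ) (t s : Term X) (c c' : k) :
    mul k n (Finsupp.single t c : TermAlg k X) (Finsupp.single s c') =
      Finsupp.single (Term.mul n t s) (c * c') := by
  simp [mul, ConformalOps.nMul]

/-- The defining relations of the free associative conformal algebra with locality function `N`:
the axioms of an associative conformal algebra, together with `a (n) b = 0` for
generators `a, b` and `n ≥ N a b`. -/
inductive Relation (N : X → X → ℕ) : TermAlg k X → Prop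
  | D_mul (n : ℕ) (a b : TermAlg k X) :
      Relation N (mul k n (D k a) b + n • mul k (n - 1) a b)
  | mul_D (n : ℕ) (a b : TermAlg k X) :
      Relation N (mul k n a (D k b) - (D k (mul k n a b) + n • mul k (n - 1) a b))
  | assoc (n m : ℕ) (a b c : TermAlg k X) :
      Relation N (mul k n a (mul k m b c) -
        ∑ s ∈ Finset.range (n + 1), n.choose s • mul k (m + s) (mul k (n - s) a b) c)
  | locality (a b : X) (n : ℕ) (hn : N a b ≤ n) :
      Relation N (mul k n (Finsupp.single (Term.of a) 1) (Finsupp.single (Term.of b) 1))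

/-- The free associative conformal algebra generated by `X` with locality function `N` on the
generators. See `conf_isAssocConformal` and `exists_unique_lift`. -/
abbrev Conf (N : X → X → ℕ) : Type (max u v) := IdealQuotient k {r | Relation k N r}

variable (N : X → X → ℕ)

/-- The generators. -/
noncomputable def gen (x : X) : Conf k N :=
  (ideal k {r | Relation k N r}).mkQ (Finsupp.single (Term.of x) 1)

theorem mkQ_rel {r : TermAlg k X} (h : Relation k N r) :
    (ideal k {r | Relation k N r}).mkQ r = 0 := by
  rw [Submodule.mkQ_apply, Submodule.Quotient.mk_eq_zero]
  exact subset_ideal k _ h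

theorem conf_D_mul (n : ℕ) (a b : Conf k N) :
    mul k n (D k a) b = -(n • mul k (n - 1) a b) := by
  obtain ⟨a, rfl⟩ := (ideal k {r | Relation k N r}).mkQ_surjective a
  obtain ⟨b, rfl⟩ := (ideal k {r | Relation k N r}).mkQ_surjective b
  have h := mkQ_rel k N (Relation.D_mul n a b)
  rw [map_add, map_nsmul] at h
  exact eq_neg_of_add_eq_zero_left h

theorem conf_mul_D (n : ℕ) (a b : Conf k N) :
    mul k n a (D k b) = D k (mul k n a b) + n • mul k (n - 1) a b := by
  obtain ⟨a, rfl⟩ := (ideal k {r | Relation k N r}).mkQ_surjective a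
  obtain ⟨b, rfl⟩ := (ideal k {r | Relation k N r}).mkQ_surjective b
  have h := mkQ_rel k N (Relation.mul_D n a b)
  rw [map_sub, map_add, map_nsmul] at h
  exact sub_eq_zero.1 h

theorem conf_assoc (n m : ℕ) (a b c : Conf k N) : mul k n a (mul k m b c) =
    ∑ s ∈ Finset.range (n + 1), n.choose s • mul k (m + s) (mul k (n - s) a b) c := by
  obtain ⟨a, rfl⟩ := (ideal k {r | Relation k N r}).mkQ_surjective a
  obtain ⟨b, rfl⟩ := (ideal k {r | Relation k N r}).mkQ_surjective b
  obtain ⟨c, rfl⟩ := (ideal k {r | Relation k N r}).mkQ_surjective c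
  have h := mkQ_rel k N (Relation.assoc n m a b c)
  rw [map_sub, map_sum] at h
  simp only [map_nsmul] at h
  exact sub_eq_zero.1 h

theorem gen_locality (a b : X) (n : ℕ) (hn : N a b ≤ n) :
    mul k n (gen k N a) (gen k N b) = 0 :=
  mkQ_rel k N (Relation.locality a b n hn)

theorem conf_induction {P : Conf k N → Prop} (h0 : P 0) (hadd : ∀ a b, P a → P b → P (a + b))
    (hsmul : ∀ (c : k) a, P a → P (c • a)) (hgen : ∀ x, P (gen k N x))
    (hD : ∀ a, P a → P (D k a)) (hmul : ∀ n a b, P a → P b → P (mul k n a b))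
    (a : Conf k N) : P a := by
  obtain ⟨a, rfl⟩ := (ideal k {r | Relation k N r}).mkQ_surjective a
  have key : ∀ t : Term X,
      P ((ideal k {r | Relation k N r}).mkQ (Finsupp.single t 1)) := by
    intro t
    induction t with
    | of x => exact hgen x
    | d t ih =>
      have h := hD _ ih
      rwa [D_mk, D_single] at h
    | mul n t s iht ihs =>
      have h := hmul n _ _ iht ihs
      rwa [mul_mk, mul_single, mul_one] at h
  induction a using Finsupp.induction_linear with
  | zero => simpa using h0
  | add f g hf hg => rw [map_add]; exact hadd _ _ hf hg
  | single t c =>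
    have h := hsmul c _ (key t)
    rwa [← map_smul, Finsupp.smul_single, smul_eq_mul, mul_one] at h

/-- If `b` and `c` are local then so are `a (n) b` and `c`, with the same bound. -/
theorem conf_mul_local {b c : Conf k N} {M : ℕ} (h : ∀ m, M ≤ m → mul k m b c = 0)
    (n : ℕ) (a : Conf k N) : ∀ m, M ≤ m → mul k m (mul k n a b) c = 0 := by
  induction n using Nat.strong_induction_on with
  | _ n ih =>
    intro m hm
    have e := conf_assoc k N n m a b c
    rw [h m hm, map_zero, Finset.sum_range_succ'] at e
    rw [Finset.sum_eq_zero] at e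
    · simpa using e.symm
    · intro s hs
      have hs' := Finset.mem_range.1 hs
      rw [ih (n - (s + 1)) (by omega) _ (by omega), smul_zero]

theorem conf_locality (a b : Conf k N) : ∃ M : ℕ, ∀ n, M ≤ n → mul k n a b = 0 := by
  revert a
  refine conf_induction k N (P := fun b => ∀ a, ∃ M : ℕ, ∀ n, M ≤ n → mul k n a b = 0)
    ?_ ?_ ?_ ?_ ?_ ?_ b
  · exact fun a => ⟨0, fun n _ => by simp⟩
  · intro b c hb hc a
    obtain ⟨M, hM⟩ := hb a
    obtain ⟨M', hM'⟩ := hc a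
    exact ⟨max M M', fun n hn => by
      rw [map_add, hM n (le_trans (le_max_left _ _) hn),
        hM' n (le_trans (le_max_right _ _) hn), add_zero]⟩
  · intro r b hb a
    obtain ⟨M, hM⟩ := hb a
    exact ⟨M, fun n hn => by rw [map_smul, hM n hn, smul_zero]⟩
  · intro y a
    refine conf_induction k N (P := fun a => ∃ M : ℕ, ∀ n, M ≤ n → mul k n a (gen k N y) = 0)
      ?_ ?_ ?_ ?_ ?_ ?_ a
    · exact ⟨0, fun n _ => by simp⟩
    · rintro a b ⟨M, hM⟩ ⟨M', hM'⟩
      exact ⟨max M M', fun n hn => by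
        rw [map_add, LinearMap.add_apply, hM n (le_trans (le_max_left _ _) hn),
          hM' n (le_trans (le_max_right _ _) hn), add_zero]⟩
    · rintro r a ⟨M, hM⟩
      exact ⟨M, fun n hn => by rw [map_smul, LinearMap.smul_apply, hM n hn, smul_zero]⟩
    · exact fun x => ⟨N x y, gen_locality k N x y⟩
    · rintro a ⟨M, hM⟩
      exact ⟨M + 1, fun n hn => by
        rw [conf_D_mul, hM (n - 1) (by omega), smul_zero, neg_zero]⟩
    · rintro n a b - ⟨M, hM⟩
      exact ⟨M, conf_mul_local k N hM n a⟩
  · intro b hb a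
    obtain ⟨M, hM⟩ := hb a
    exact ⟨M + 1, fun n hn => by
      rw [conf_mul_D, hM (n - 1) (by omega), hM n (by omega), smul_zero, map_zero, add_zero]⟩
  · intro j p q hp hq a
    obtain ⟨M, hM⟩ := hp a
    obtain ⟨M', hM'⟩ := hq p
    refine ⟨M + M', fun n hn => ?_⟩
    rw [conf_assoc]
    refine Finset.sum_eq_zero fun s hs => ?_
    have hs' := Finset.mem_range.1 hs
    by_cases h : M ≤ n - s
    · rw [hM _ h, map_zero, LinearMap.zero_apply, smul_zero]
    · rw [conf_mul_local k N hM' _ a (j + s) (by omega), smul_zero]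

/-- `Conf k N` is an associative conformal algebra. -/
instance conf_isAssocConformal : IsAssocConformal k (Conf k N) where
  locality := conf_locality k N
  D_mul := conf_D_mul k N
  mul_D := conf_mul_D k N
  assoc := conf_assoc k N

/-- The value of a formal expression. -/
def Term.eval {C : Type w} [AddCommGroup C] [Module k C] [ConformalOps k C] (f : X → C) :
    Term X → C
  | .of x => f x
  | .d t => ConfAlg.D k (Term.eval f t)
  | .mul n t s => ConfAlg.mul k n (Term.eval f t) (Term.eval f s)

/-- The universal property of `Conf k N`. -/
theorem exists_unique_lift {C : Type w} [AddCommGroup C] [Module k C] [ConformalOps k C]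
    [IsAssocConformal k C] (f : X → C)
    (hf : ∀ (a b : X) (n : ℕ), N a b ≤ n → mul k n (f a) (f b) = 0) :
    ∃! φ : Conf k N →ₗ[k] C, (∀ x, φ (gen k N x) = f x) ∧ (∀ a, φ (D k a) = D k (φ a)) ∧
      ∀ n a b, φ (mul k n a b) = mul k n (φ a) (φ b) := by
  let e : TermAlg k X →ₗ[k] C := Finsupp.linearCombination k (Term.eval k f)
  have eD : ∀ a, e (D k a) = D k (e a) := by
    intro a
    induction a using Finsupp.induction_linear with
    | zero => simp
    | add p q hp hq => simp only [map_add, hp, hq]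
    | single t c => simp [e, D_single, Term.eval]
  have emul : ∀ n a b, e (mul k n a b) = mul k n (e a) (e b) := by
    intro n a b
    induction a using Finsupp.induction_linear with
    | zero => simp
    | add p q hp hq => simp only [map_add, LinearMap.add_apply, hp, hq]
    | single t c =>
      induction b using Finsupp.induction_linear with
      | zero => simp
      | add p q hp hq => simp only [map_add, hp, hq]
      | single s c' =>
        rw [mul_single]
        simp only [e, Finsupp.linearCombination_single, Term.eval, map_smul, LinearMap.smul_apply,
          smul_smul, mul_comm]
  have hker : ideal k {r | Relation k N r} ≤ LinearMap.ker e := by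
    refine ideal_le k ⟨fun a ha => ?_, fun n a b hb => ?_, fun n a b ha => ?_⟩ ?_
    · rw [LinearMap.mem_ker] at ha ⊢
      rw [eD, ha, map_zero]
    · rw [LinearMap.mem_ker] at hb ⊢
      rw [emul, hb, map_zero]
    · rw [LinearMap.mem_ker] at ha ⊢
      rw [emul, ha, map_zero, LinearMap.zero_apply]
    · intro r hr
      change e r = 0
      cases hr with
      | D_mul n a b => simp [emul, eD, IsAssocConformal.D_mul]
      | mul_D n a b => simp only [map_sub, map_add, map_nsmul, emul, eD,
          IsAssocConformal.mul_D, sub_self]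
      | assoc n m a b c => simp only [map_sub, map_sum, map_nsmul, emul,
          IsAssocConformal.assoc, sub_self]
      | locality a b n hn => simpa [emul, e, Term.eval] using hf a b n hn
  refine ⟨Submodule.liftQ _ e hker, ⟨fun x => ?_, fun a => ?_, fun n a b => ?_⟩, ?_⟩
  · simp [gen, e, Term.eval]
  · obtain ⟨a, rfl⟩ := (ideal k {r | Relation k N r}).mkQ_surjective a
    exact eD a
  · obtain ⟨a, rfl⟩ := (ideal k {r | Relation k N r}).mkQ_surjective a
    obtain ⟨b, rfl⟩ := (ideal k {r | Relation k N r}).mkQ_surjective b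
    exact emul n a b
  · rintro ψ ⟨h1, h2, h3⟩
    ext1
    ext t
    induction t with
    | of x => simpa [e, Term.eval, gen] using h1 x
    | d t ih =>
      have h := h2 ((ideal k {r | Relation k N r}).mkQ (Finsupp.single t 1))
      rw [D_mk, D_single] at h
      simp [e, Term.eval] at ih h ⊢
      rw [h, ih]
    | mul n t s iht ihs =>
      have h := h3 n ((ideal k {r | Relation k N r}).mkQ (Finsupp.single t 1))
        ((ideal k {r | Relation k N r}).mkQ (Finsupp.single s 1))
      rw [mul_mk, mul_single, mul_one] at h
      simp [e, Term.eval] at iht ihs h ⊢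
      rw [h, iht, ihs]

end Free

/-! ### Words, the monomial order, Gröbner–Shirshov bases -/

/-- The alphabet `O` of operators `∂`, `L_n^a`, `R_n^a`. -/
inductive Op (X : Type u) : Type u
  | d : Op X
  | L : ℕ → X → Op X
  | R : ℕ → X → Op X

/-- The alphabet `Z`, the disjoint union of `O` and `X`. -/
abbrev Letter (X : Type u) : Type u := Op X ⊕ X

/-- Words (possibly empty) in the alphabet `Z`. -/
abbrev Word (X : Type u) : Type u := List (Letter X)

/-- The strict order on operators: `∂ < L_n^a < R_m^b`, and `L_n^a < L_m^b` iff `n < m` or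
`n = m`, `a < b`; similarly for `R`. -/
def Op.lt {X : Type u} [LinearOrder X] : Op X → Op X → Prop
  | .d, .d => False
  | .d, .L _ _ => True
  | .d, .R _ _ => True
  | .L _ _, .d => False
  | .L n a, .L m b => n < m ∨ n = m ∧ a < b
  | .L _ _, .R _ _ => True
  | .R _ _, .d => False
  | .R _ _, .L _ _ => False
  | .R n a, .R m b => n < m ∨ n = m ∧ a < b

/-- The order on `Z`: as above on `O`, the given one on `X`, and `O < X`. -/
def letterLT {X : Type u} [LinearOrder X] : Letter X → Letter X → Prop :=
  Sum.Lex Op.lt (· < ·)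

/-- Number of letters from `X` in a word. -/
def genDegree {X : Type u} (w : Word X) : ℕ :=
  w.countP fun z => match z with
    | .inr _ => true
    | .inl _ => false

/-- Number of letters `R_n^a` in a word. -/
def rDegree {X : Type u} (w : Word X) : ℕ :=
  w.countP fun z => match z with
    | .inl (.R _ _) => true
    | _ => false

/-- The monomial order on words in `Z`: compare first the number of letters from `X`, then the
number of letters `R_n^a`, then the length, and then lexicographically. On words in `O` this is
comparison by the degree in the `R_n^a` followed by deg-lex. Words in `O` precede words `u x`
(`u` a word in `O`, `x ∈ X`), and `u x` precedes `v y` iff `u` precedes `v`, or `u = v` and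
`x < y`; see `wordLT_module`. -/
def wordLT {X : Type u} [LinearOrder X] (w w' : Word X) : Prop :=
  genDegree w < genDegree w' ∨ genDegree w = genDegree w' ∧
    (rDegree w < rDegree w' ∨ rDegree w = rDegree w' ∧
      (w.length < w'.length ∨ w.length = w'.length ∧ List.Lex letterLT w w'))

theorem list_lex_append_singleton {α : Type u} {β : Type v} {r : α → α → Prop} {t : β → β → Prop}
    (p q : List α) (x y : β) (h : p.length = q.length) :
    List.Lex (Sum.Lex r t) (p.map Sum.inl ++ [Sum.inr x]) (q.map Sum.inl ++ [Sum.inr y]) ↔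
      List.Lex (Sum.Lex r t) (p.map Sum.inl) (q.map Sum.inl) ∨ p = q ∧ t x y := by
  induction p generalizing q with
  | nil =>
    obtain rfl : q = [] := by simpa using h.symm
    simp
  | cons a p ih =>
    obtain _ | ⟨b, q⟩ := q
    · simp at h
    · have ih' := ih q (by simpa using h)
      have cons_iff : ∀ (l l' : List (α ⊕ β)),
          List.Lex (Sum.Lex r t) (Sum.inl a :: l) (Sum.inl b :: l') ↔
            r a b ∨ a = b ∧ List.Lex (Sum.Lex r t) l l' := by
        intro l l'
        constructor
        · intro h
          cases h with
          | rel h => exact .inl (Sum.lex_inl_inl.1 h)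
          | cons h => exact .inr ⟨rfl, h⟩
        · rintro (h' | ⟨rfl, h'⟩)
          · exact .rel (.inl h')
          · exact .cons h'
      rw [List.map_cons, List.map_cons, List.cons_append, List.cons_append, cons_iff, cons_iff,
        ih', List.cons.injEq]
      tauto

theorem wordLT_module {X : Type u} [LinearOrder X] (p q : List (Op X)) (x y : X) :
    wordLT (p.map Sum.inl ++ [Sum.inr x]) (q.map Sum.inl ++ [Sum.inr y]) ↔
      wordLT (p.map Sum.inl) (q.map Sum.inl) ∨ p = q ∧ x < y := by
  have g0 : ∀ l : List (Op X), genDegree (l.map Sum.inl : Word X) = 0 := by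
    intro l
    simp [genDegree, List.countP_eq_zero]
  have g1 : ∀ (l : List (Op X)) (z : X),
      genDegree (l.map Sum.inl ++ [Sum.inr z] : Word X) = 1 := by
    intro l z
    have := g0 l
    unfold genDegree at this ⊢
    rw [List.countP_append, this]
    simp
  have r1 : ∀ (l : List (Op X)) (z : X), rDegree (l.map Sum.inl ++ [Sum.inr z] : Word X) =
      rDegree (l.map Sum.inl : Word X) := by
    intro l z
    unfold rDegree
    rw [List.countP_append]
    simp
  unfold wordLT
  rw [g0, g0, g1, g1, r1, r1]
  simp only [lt_irrefl, false_or, true_and, List.length_append, List.length_map,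
    List.length_singleton, add_lt_add_iff_right, add_left_inj]
  by_cases hl : p.length = q.length
  · unfold letterLT
    rw [list_lex_append_singleton p q x y hl]
    by_cases hpq : p = q
    · subst hpq; simp
    · simp [hpq]
  · have hpq : p ≠ q := fun h => hl (by rw [h])
    simp [hl, hpq]

section GSB

variable {k : Type v} [Field k] {X : Type u} [LinearOrder X]

/-- The free associative algebra `k⟨Z⟩`, with the words in `Z` as a basis. -/
abbrev FreeAlg (k : Type v) [Field k] (X : Type u) : Type (max u v) :=
  MonoidAlgebra k (FreeMonoid (Letter X))

/-- A word as an element of `k⟨Z⟩`. -/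
noncomputable def mono (k : Type v) [Field k] {X : Type u} (w : Word X) : FreeAlg k X :=
  MonoidAlgebra.single (FreeMonoid.ofList w) 1

/-- `w` is the principal monomial of `f`. -/
def IsLeading (f : FreeAlg k X) (w : Word X) : Prop :=
  f.coeff (FreeMonoid.ofList w) ≠ 0 ∧
    ∀ w' : Word X, f.coeff (FreeMonoid.ofList w') ≠ 0 → w' ≠ w → wordLT w' w

/-- `f` is nonzero and the coefficient of its principal monomial is `1`. -/
def IsMonic (f : FreeAlg k X) : Prop :=
  ∃ w : Word X, IsLeading f w ∧ f.coeff (FreeMonoid.ofList w) = 1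

/-- `f` is trivial modulo `T` and `w`: it is a linear combination of elements `u s v` with `s ∈ T`
and `u s̄ v` smaller than `w`. -/
def IsTrivialMod (T : Set (FreeAlg k X)) (w : Word X) (f : FreeAlg k X) : Prop :=
  f ∈ Submodule.span k {p | ∃ s ∈ T, ∃ l u v : Word X, IsLeading s l ∧
    wordLT (u ++ l ++ v) w ∧ p = mono k u * s * mono k v}

/-- `h` is a composition of `f` and `g` relative to the word `w`. -/
inductive IsComposition (f g : FreeAlg k X) : Word X → FreeAlg k X → Prop
  | inclusion (lg u v : Word X) (hf : IsLeading f (u ++ lg ++ v)) (hg : IsLeading g lg) :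
      IsComposition f g (u ++ lg ++ v) (f - mono k u * g * mono k v)
  | intersection (u₁ u₂ v₂ : Word X) (h₁ : u₁ ≠ []) (h₂ : u₂ ≠ []) (h₃ : v₂ ≠ [])
      (hf : IsLeading f (u₁ ++ u₂)) (hg : IsLeading g (u₂ ++ v₂)) :
      IsComposition f g (u₁ ++ u₂ ++ v₂) (f * mono k v₂ - mono k u₁ * g)

/-- Gröbner–Shirshov bases in `k⟨Z⟩`: sets of monic polynomials all of whose compositions are
trivial. -/
def IsGSB (T : Set (FreeAlg k X)) : Prop :=
  (∀ f ∈ T, IsMonic f) ∧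
    ∀ f ∈ T, ∀ g ∈ T, ∀ (w : Word X) (h : FreeAlg k X), IsComposition f g w h →
      IsTrivialMod T w h

/-- The defining relations of the algebra `A(X)`. -/
inductive AlgRel : FreeAlg k X → Prop
  | L_d (n : ℕ) (a : X) : AlgRel (mono k [.inl (.L n a), .inl .d] -
      mono k [.inl .d, .inl (.L n a)] - n • mono k [.inl (.L (n - 1) a)])
  | R_d (n : ℕ) (a : X) : AlgRel (mono k [.inl (.R n a), .inl .d] -
      mono k [.inl .d, .inl (.R n a)] - n • mono k [.inl (.R (n - 1) a)])
  | R_L (n m : ℕ) (a b : X) : AlgRel (mono k [.inl (.R m b), .inl (.L n a)] -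
      mono k [.inl (.L n a), .inl (.R m b)])

/-- The words `x a` and `x y` with `x, y ∈ X` and `a ∈ O`. -/
def nullExt (k : Type v) [Field k] (X : Type u) : Set (FreeAlg k X) :=
  {p | ∃ (x : X) (z : Letter X), p = mono k [.inr x, z]}

/-- `T` is a Gröbner–Shirshov basis in the free `A(X)`-module `F(X)` generated by `X` (elements of
which are represented by combinations of words `u x`, with `u` a word in `O` and `x ∈ X`). -/
def IsModuleGSB (T : Set (FreeAlg k X)) : Prop :=
  IsGSB (T ∪ {p | AlgRel p} ∪ nullExt k X)

end GSB

/-! ### Normal words, Gröbner–Shirshov bases in `Conf k N` -/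

/-- The normality condition for `L_{n₁}^{a₁} ⋯ L_{n_k}^{a_k} c`, encoded by the list of the pairs
`(n_i, a_i)` and by `c`: one has `n_i < N a_i a_{i+1}` for `i < k`, and `n_k < N a_k c`. -/
def IsNormalList {X : Type u} (N : X → X → ℕ) (c : X) : List (ℕ × X) → Prop
  | [] => True
  | (n, a) :: l => n < N a ((l.head?.map Prod.snd).getD c) ∧ IsNormalList N c l

/-- The normal words `∂^s L_{n₁}^{a₁} ⋯ L_{n_k}^{a_k} c`. -/
structure NormalWord {X : Type u} (N : X → X → ℕ) : Type u where
  s : ℕ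
  l : List (ℕ × X)
  c : X
  normal : IsNormalList N c l

/-- The word `∂^s L_{n₁}^{a₁} ⋯ L_{n_k}^{a_k} c`. -/
def lWord {X : Type u} (s : ℕ) (l : List (ℕ × X)) (c : X) : Word X :=
  List.replicate s (.inl .d) ++ l.map (fun p => .inl (.L p.1 p.2)) ++ [.inr c]

section Conformal

variable (k : Type v) [Field k] {X : Type u}

/-- A normal word as a word in `Z`. -/
def NormalWord.word {N : X → X → ℕ} (b : NormalWord N) : Word X := lWord b.s b.l b.c

/-- A normal word as an element of the free associative conformal algebra:
`∂^s (a₁ (n₁) (a₂ (n₂) ⋯ (a_k (n_k) c) ⋯ ))`. -/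
noncomputable def NormalWord.value {N : X → X → ℕ} (b : NormalWord N) : Conf k N :=
  (D k : Conf k N →ₗ[k] Conf k N)^[b.s]
    (b.l.foldr (fun p z => mul k p.1 (gen k N p.2) z) (gen k N b.c))

variable (N : X → X → ℕ)

/-- The relations `Σ(X,N)`; `lWord 0 l c` with `IsNormalList N c l` are the `∂`-free normal
words. -/
inductive FreeRel : FreeAlg k X → Prop
  | locality (a b : X) (n : ℕ) (hn : N a b ≤ n) :
      FreeRel (mono k [.inl (.L n a), .inr b])
  | right (a b : X) (n : ℕ) :
      FreeRel (mono k [.inl (.R n b), .inr a] - ∑ s ∈ Finset.range (N a b - n),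
        ((-1) ^ (n + s) * (s.factorial : k)⁻¹) • mono k (lWord s [(n + s, a)] b))
  | extended (a b : X) (n m : ℕ) (hn : N a b ≤ n) (l : List (ℕ × X)) (c : X)
      (hl : IsNormalList N c l) :
      FreeRel (mono k (lWord 0 ((n, a) :: (m, b) :: l) c) +
        ∑ q ∈ Finset.Icc 1 n, ((-1) ^ q * (n.choose q : k)) •
          mono k (lWord 0 ((n - q, a) :: (m + q, b) :: l) c))

variable {N}

/-- A set `S` of elements of the free associative conformal algebra, rewritten as a set of linear
combinations of normal words in `F(X)`. -/
def normalForms (S : Set (Conf k N)) : Set (FreeAlg k X) :=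
  {p | ∃ f : NormalWord N →₀ k,
    Finsupp.linearCombination k (NormalWord.value k) f ∈ S ∧
    p = Finsupp.linearCombination k (fun b : NormalWord N => mono k b.word) f}

/-- `S` is a Gröbner–Shirshov basis in the free associative conformal algebra. -/
def IsConfGSB [LinearOrder X] (S : Set (Conf k N)) : Prop :=
  IsModuleGSB (normalForms k S ∪ {p | FreeRel k N p})

/-- The normal word `b` is `S`-reduced: it contains no principal monomial of an element of `S`. -/
def IsReduced [LinearOrder X] (S : Set (Conf k N)) (b : NormalWord N) : Prop :=
  ∀ p ∈ normalForms k S, ∀ l u v : Word X, IsLeading p l → b.word ≠ u ++ l ++ v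

end Conformal

end ConfAlg

/-! The equivalence is a diamond lemma combined with a faithful enough model of `Conf(X,N)`.

For a conformal algebra `C` with generators of the given locality, `k⟨Z⟩` acts on `k × C`
(`action`). The letter `R_n^b` acts as `z ↦ ∑ (-1)^(n+s) ∂^(s) (z (n+s) b)`, a form of right
multiplication that commutes with left multiplication (`rOp_mul`). All defining relations act by
zero, so `represent` turns rewriting of words into equalities in `Conf(X,N)` and in its quotients. A
subspace stable under `∂`, `L_n^a`, `R_n^a` is an ideal (`isIdeal_of_operators`), so membership in
the ideal of `S` is a matter of these operators only (`ideal_le_map_represent`).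

A word with a letter from `X` is normal or contains the principal word of a relation
(`relLead_or_normal`). Well-founded rewriting (`mono_mem_sup`) then expresses it through reduced
normal words modulo multiples of relations with principal words not above it. Hence the reduced
words always span the quotient, and only their independence is at stake.

If they are independent, a composition with a letter from `X` acts by zero, so the reduced part left
by rewriting represents zero and vanishes: the composition is trivial. Compositions without letters
from `X` come from `A(X)`, where `R L ∂` is the only overlap (`R_L_d_trivial`).

If all compositions are trivial, a reduced combination lying in the ideal is a consequence of the
relations, and `IsGSB.eq_zero` forces it to vanish. This uses that an element of `F(X)` representing
zero in `Conf(X,N)` already follows from the relations without `S`, which amounts to independence of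
all normal words (`linearIndependent_value`). That is seen in a model: words in derivatives `a^(i)`
with `a^(i) b^(n) = 0` for `n ≥ N(a,b)`, a derivation `d` on them, and the generator `a` sent to the
sequence of operators `a d^n`. There normal words acquire distinct lexicographically principal
words. -/

namespace ConfAlg

universe u v w

/-! ### The monomial order -/

section Order

variable {X : Type u}

/-- An order embedding of the alphabet into a lexicographic product of linear orders. -/
def letterKey : Letter X → ℕ ×ₗ (ℕ ×ₗ WithBot X)
  | .inl .d => toLex (0, toLex (0, ⊥))
  | .inl (.L n a) => toLex (1, toLex (n, a))
  | .inl (.R n a) => toLex (2, toLex (n, a))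
  | .inr x => toLex (3, toLex (0, x))

theorem letterKey_injective : Function.Injective (letterKey (X := X)) := by
  rintro ((_ | ⟨n, a⟩ | ⟨n, a⟩) | x) ((_ | ⟨m, b⟩ | ⟨m, b⟩) | y) <;> simp [letterKey]

theorem genDegree_append (w w' : Word X) : genDegree (w ++ w') = genDegree w + genDegree w' :=
  List.countP_append

theorem genDegree_eq_zero_of_append {u l v : Word X} (h : genDegree (u ++ l ++ v) = 0) :
    genDegree l = 0 := by
  simp only [genDegree_append] at h
  omega

theorem rDegree_append (w w' : Word X) : rDegree (w ++ w') = rDegree w + rDegree w' :=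
  List.countP_append

/-- An order embedding of words with the monomial order into a linear order. -/
def wordKey (w : Word X) : ℕ ×ₗ (ℕ ×ₗ (ℕ ×ₗ List (ℕ ×ₗ (ℕ ×ₗ WithBot X)))) :=
  toLex (genDegree w, toLex (rDegree w, toLex (w.length, w.map letterKey)))

theorem wordKey_injective : Function.Injective (wordKey (X := X)) := by
  intro w w' h
  simp only [wordKey, EmbeddingLike.apply_eq_iff_eq, Prod.mk.injEq] at h
  exact letterKey_injective.list_map h.2.2.2

variable [LinearOrder X]

theorem letterLT_iff (z z' : Letter X) : letterLT z z' ↔ letterKey z < letterKey z' := by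
  rcases z with ((_ | ⟨n, a⟩ | ⟨n, a⟩) | x) <;> rcases z' with ((_ | ⟨m, b⟩ | ⟨m, b⟩) | y) <;>
    simp [letterKey, letterLT, Op.lt, Prod.Lex.toLex_lt_toLex]

theorem lex_iff_map_letterKey (w w' : Word X) :
    List.Lex letterLT w w' ↔ w.map letterKey < w'.map letterKey := by
  change _ ↔ List.Lex (· < ·) _ _
  induction w generalizing w' with
  | nil => cases w' <;> simp
  | cons z w ih =>
    cases w' with
    | nil => simp
    | cons z' w' =>
      simp only [List.map_cons]
      constructor
      · intro h
        cases h with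
        | rel h => exact .rel ((letterLT_iff _ _).1 h)
        | cons h => exact .cons ((ih _).1 h)
      · intro h
        generalize hz : letterKey z = p, hz' : letterKey z' = q at h
        cases h with
        | rel h => subst hz hz'; exact .rel ((letterLT_iff _ _).2 h)
        | cons h =>
          obtain rfl := letterKey_injective (hz.trans hz'.symm)
          exact .cons ((ih _).2 h)

theorem wordLT_iff (w w' : Word X) : wordLT w w' ↔ wordKey w < wordKey w' := by
  simp [wordLT, wordKey, Prod.Lex.toLex_lt_toLex, lex_iff_map_letterKey]

theorem wordLT_irrefl (w : Word X) : ¬ wordLT w w := by simp [wordLT_iff]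

theorem wordLT_trans {w₁ w₂ w₃ : Word X} (h : wordLT w₁ w₂) (h' : wordLT w₂ w₃) :
    wordLT w₁ w₃ := by
  rw [wordLT_iff] at *
  exact h.trans h'

theorem wordLT_trichotomy (w w' : Word X) : wordLT w w' ∨ w = w' ∨ wordLT w' w := by
  simp only [wordLT_iff, ← wordKey_injective.eq_iff]
  exact lt_trichotomy _ _

theorem letterLT_wellFounded [WellFoundedLT X] : WellFounded (letterLT (X := X)) := by
  have : WellFoundedLT (ℕ ×ₗ (ℕ ×ₗ WithBot X)) := inferInstance
  exact Subrelation.wf (fun {a b} h => (letterLT_iff a b).1 h) (InvImage.wf letterKey this.wf)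

/-- The embedding `wordKey` cannot serve here, since the lexicographic order on lists is not
well-founded. Comparing lengths before comparing letters is the shortlex order, which is
well-founded over a well-founded alphabet. -/
theorem wordLT_wellFounded [WellFoundedLT X] : WellFounded (wordLT (X := X)) := by
  have h := WellFounded.prod_lex (wellFounded_lt (α := ℕ))
    (WellFounded.prod_lex (wellFounded_lt (α := ℕ))
      (List.Shortlex.wf (letterLT_wellFounded (X := X))))
  refine Subrelation.wf ?_ (InvImage.wf (fun w : Word X => (genDegree w, rDegree w, w)) h)
  intro a b hab
  simpa [InvImage, Prod.lex_def, List.shortlex_def, wordLT] using hab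

/-- Equal lengths exclude the case of a proper prefix, which is the one that appending `v` could
spoil. -/
theorem lex_append_right {α : Type*} {r : α → α → Prop} {p q : List α} (v : List α)
    (h : List.Lex r p q) (hl : p.length = q.length) : List.Lex r (p ++ v) (q ++ v) := by
  induction h with
  | nil => simp at hl
  | cons _ ih => exact .cons (ih (by simpa using hl))
  | rel h => exact .rel h

theorem lex_append_left {α : Type*} {r : α → α → Prop} {p q : List α} (u : List α)
    (h : List.Lex r p q) : List.Lex r (u ++ p) (u ++ q) := by
  induction u with
  | nil => exact h
  | cons a u ih => exact .cons ih

theorem wordLT_append {p q : Word X} (u v : Word X) (h : wordLT p q) :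
    wordLT (u ++ p ++ v) (u ++ q ++ v) := by
  simp only [wordLT, genDegree_append, rDegree_append, List.length_append] at h ⊢
  rcases h with h | ⟨h1, h | ⟨h2, h | ⟨h3, h⟩⟩⟩
  · exact .inl (by omega)
  · exact .inr ⟨by omega, .inl (by omega)⟩
  · exact .inr ⟨by omega, .inr ⟨by omega, .inl (by omega)⟩⟩
  · refine .inr ⟨by omega, .inr ⟨by omega, .inr ⟨by omega, ?_⟩⟩⟩
    exact lex_append_right v (lex_append_left u h) (by simp [h3])

end Order

/-! ### Leading words -/

section Leading

variable {k : Type v} [Field k] {X : Type u}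

theorem mono_mul_mono (p q : Word X) : mono k p * mono k q = mono k (p ++ q) := by
  simp [mono, MonoidAlgebra.single_mul_single]

theorem mono_nil : mono k ([] : Word X) = 1 := rfl

theorem coeff_mono (p q : Word X) [Decidable (p = q)] :
    (mono k p).coeff (FreeMonoid.ofList q) = if p = q then 1 else 0 := by
  classical
  simp [mono, Finsupp.single_apply]

theorem eq_linearCombination_mono (f : FreeAlg k X) :
    f = Finsupp.linearCombination k (fun m => mono k (FreeMonoid.toList m)) f.coeff := by
  conv_lhs => rw [← MonoidAlgebra.sum_coeff_single f]
  simp [Finsupp.linearCombination_apply, mono]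

/-- The span of a set of words. -/
noncomputable def wordSpan (k : Type v) [Field k] {X : Type u} (P : Word X → Prop) :
    Submodule k (FreeAlg k X) :=
  Submodule.span k {p | ∃ w, P w ∧ p = mono k w}

theorem mono_mem_wordSpan {P : Word X → Prop} {w : Word X} (h : P w) :
    mono k w ∈ wordSpan k P := Submodule.subset_span ⟨w, h, rfl⟩

theorem mem_wordSpan_of_coeff {P : Word X → Prop} {f : FreeAlg k X}
    (h : ∀ w, f.coeff (FreeMonoid.ofList w) ≠ 0 → P w) : f ∈ wordSpan k P := by
  rw [eq_linearCombination_mono f, Finsupp.linearCombination_apply]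
  refine Submodule.sum_mem _ fun m hm => Submodule.smul_mem _ _ (mono_mem_wordSpan (h _ ?_))
  simpa using hm

theorem coeff_of_mem_wordSpan {P : Word X → Prop} {f : FreeAlg k X} (hf : f ∈ wordSpan k P)
    {w : Word X} (hw : ¬ P w) : f.coeff (FreeMonoid.ofList w) = 0 := by
  classical
  induction hf using Submodule.span_induction with
  | mem x hx =>
    obtain ⟨q, hq, rfl⟩ := hx
    rw [coeff_mono, if_neg (by rintro rfl; exact hw hq)]
  | zero => simp
  | add x y _ _ hx hy => simp [hx, hy]
  | smul a x _ hx => simp [hx]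

theorem wordSpan_mono {P Q : Word X → Prop} (h : ∀ w, P w → Q w) :
    wordSpan k P ≤ wordSpan k Q :=
  Submodule.span_mono fun _ ⟨w, hw, e⟩ => ⟨w, h w hw, e⟩

theorem mul_mem_wordSpan {P Q : Word X → Prop} (u v : Word X) (h : ∀ w, P w → Q (u ++ w ++ v))
    {f : FreeAlg k X} (hf : f ∈ wordSpan k P) : mono k u * f * mono k v ∈ wordSpan k Q := by
  induction hf using Submodule.span_induction with
  | mem x hx =>
    obtain ⟨q, hq, rfl⟩ := hx
    rw [mono_mul_mono, mono_mul_mono]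
    exact mono_mem_wordSpan (h q hq)
  | zero => simp
  | add x y _ _ hx hy => rw [mul_add, add_mul]; exact add_mem hx hy
  | smul a x _ hx => rw [mul_smul_comm, smul_mul_assoc]; exact Submodule.smul_mem _ _ hx

variable [LinearOrder X]

theorem IsLeading.unique {f : FreeAlg k X} {l l' : Word X} (h : IsLeading f l)
    (h' : IsLeading f l') : l = l' := by
  by_contra hne
  exact wordLT_irrefl _ (wordLT_trans (h.2 _ h'.1 (Ne.symm hne)) (h'.2 _ h.1 hne))

/-- `f` has principal monomial `l` with coefficient one. -/
theorem isLeading_of_sub_mem {f : FreeAlg k X} {l : Word X}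
    (h : f - mono k l ∈ wordSpan k (wordLT · l)) :
    IsLeading f l ∧ f.coeff (FreeMonoid.ofList l) = 1 := by
  classical
  have hc : ∀ w, ¬ wordLT w l →
      f.coeff (FreeMonoid.ofList w) = if l = w then 1 else 0 := by
    intro w hw
    have := coeff_of_mem_wordSpan h hw
    rw [MonoidAlgebra.coeff_sub, Finsupp.sub_apply, coeff_mono, sub_eq_zero] at this
    exact this
  have hl := hc l (wordLT_irrefl l)
  rw [if_pos rfl] at hl
  refine ⟨⟨by simp [hl], fun w hw hne => ?_⟩, hl⟩
  by_contra hlt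
  exact hw (by rw [hc w hlt, if_neg (Ne.symm hne)])

/-- The span also remembers that its words occur in `f`. For normal forms this makes every word of
the tail a normal word. -/
theorem IsMonic.sub_mem {f : FreeAlg k X} (hf : IsMonic f) {l : Word X} (hl : IsLeading f l) :
    f - mono k l ∈ wordSpan k (fun w => f.coeff (FreeMonoid.ofList w) ≠ 0 ∧ wordLT w l) := by
  classical
  obtain ⟨l', hl', h1⟩ := hf
  obtain rfl := hl.unique hl'
  refine mem_wordSpan_of_coeff fun w hw => ?_
  rw [MonoidAlgebra.coeff_sub, Finsupp.sub_apply, coeff_mono] at hw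
  by_cases e : l = w
  · subst e; simp [h1] at hw
  · rw [if_neg e, sub_zero] at hw
    exact ⟨hw, hl.2 _ hw (Ne.symm e)⟩

end Leading

/-! ### The diamond lemma -/

section Diamond

variable {k : Type v} [Field k] {X : Type u} [LinearOrder X]

/-- The span of the elements `u s v` with `s ∈ T` such that `u s̄ v` satisfies `P`. -/
noncomputable def multSpan (T : Set (FreeAlg k X)) (P : Word X → Prop) :
    Submodule k (FreeAlg k X) :=
  Submodule.span k {p | ∃ s ∈ T, ∃ l u v : Word X, IsLeading s l ∧ P (u ++ l ++ v) ∧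
    p = mono k u * s * mono k v}

theorem isTrivialMod_iff {T : Set (FreeAlg k X)} {w : Word X} {f : FreeAlg k X} :
    IsTrivialMod T w f ↔ f ∈ multSpan T (wordLT · w) := Iff.rfl

variable {T : Set (FreeAlg k X)}

theorem mem_multSpan {P : Word X → Prop} {s : FreeAlg k X} (hs : s ∈ T) {l u v : Word X}
    (hl : IsLeading s l) (h : P (u ++ l ++ v)) : mono k u * s * mono k v ∈ multSpan T P :=
  Submodule.subset_span ⟨s, hs, l, u, v, hl, h, rfl⟩

theorem multSpan_mono {T' : Set (FreeAlg k X)} {P Q : Word X → Prop} (hT : T ⊆ T')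
    (h : ∀ w, P w → Q w) : multSpan T P ≤ multSpan T' Q :=
  Submodule.span_mono fun _ ⟨s, hs, l, u, v, hl, hp, e⟩ => ⟨s, hT hs, l, u, v, hl, h _ hp, e⟩

theorem mul_mem_multSpan {P Q : Word X → Prop} (u v : Word X) (h : ∀ w, P w → Q (u ++ w ++ v))
    {f : FreeAlg k X} (hf : f ∈ multSpan T P) : mono k u * f * mono k v ∈ multSpan T Q := by
  induction hf using Submodule.span_induction with
  | mem x hx =>
    obtain ⟨s, hs, l, u', v', hl, hp, rfl⟩ := hx
    have e : mono k u * (mono k u' * s * mono k v') * mono k v =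
        mono k (u ++ u') * s * mono k (v' ++ v) := by
      simp only [← mono_mul_mono, mul_assoc]
    rw [e]
    refine mem_multSpan hs hl ?_
    have := h _ hp
    simpa only [List.append_assoc] using this
  | zero => simp
  | add x y _ _ hx hy => rw [mul_add, add_mul]; exact add_mem hx hy
  | smul a x _ hx => rw [mul_smul_comm, smul_mul_assoc]; exact Submodule.smul_mem _ _ hx

theorem multSpan_le_wordSpan (hT : ∀ f ∈ T, IsMonic f) (w : Word X) :
    multSpan T (wordLT · w) ≤ wordSpan k (wordLT · w) := by
  refine Submodule.span_le.2 ?_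
  rintro _ ⟨s, hs, l, u, v, hl, hp, rfl⟩
  have h := mul_mem_wordSpan (Q := (wordLT · w)) u v
    (fun q hq => wordLT_trans (wordLT_append u v hq.2) hp) ((hT s hs).sub_mem hl)
  rw [mul_sub, sub_mul, mono_mul_mono, mono_mul_mono] at h
  have h' : mono k (u ++ l ++ v) ∈ wordSpan k (wordLT · w) := mono_mem_wordSpan hp
  simpa using add_mem h h'

theorem mul_mem_multSpan_of_mem_wordSpan_right {P Q : Word X → Prop} {s : FreeAlg k X}
    (hs : s ∈ T) {l : Word X} (hl : IsLeading s l) (u m v : Word X)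
    (h : ∀ q, P q → Q (u ++ l ++ (m ++ q ++ v))) {f : FreeAlg k X} (hf : f ∈ wordSpan k P) :
    mono k u * s * mono k m * f * mono k v ∈ multSpan T Q := by
  induction hf using Submodule.span_induction with
  | mem x hx =>
    obtain ⟨q, hq, rfl⟩ := hx
    have e : mono k u * s * mono k m * mono k q * mono k v =
        mono k u * s * mono k (m ++ q ++ v) := by
      simp only [← mono_mul_mono, mul_assoc]
    rw [e]
    exact mem_multSpan hs hl (h q hq)
  | zero => simp
  | add x y _ _ hx hy => rw [mul_add, add_mul]; exact add_mem hx hy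
  | smul a x _ hx => rw [mul_smul_comm, smul_mul_assoc]; exact Submodule.smul_mem _ _ hx

theorem mul_mem_multSpan_of_mem_wordSpan_left {P Q : Word X → Prop} {s : FreeAlg k X}
    (hs : s ∈ T) {l : Word X} (hl : IsLeading s l) (u m v : Word X)
    (h : ∀ q, P q → Q (u ++ q ++ m ++ l ++ v)) {f : FreeAlg k X} (hf : f ∈ wordSpan k P) :
    mono k u * f * mono k m * s * mono k v ∈ multSpan T Q := by
  induction hf using Submodule.span_induction with
  | mem x hx =>
    obtain ⟨q, hq, rfl⟩ := hx
    have e : mono k u * mono k q * mono k m * s * mono k v =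
        mono k (u ++ q ++ m) * s * mono k v := by
      simp only [← mono_mul_mono, mul_assoc]
    rw [e]
    exact mem_multSpan hs hl (h q hq)
  | zero => simp
  | add x y _ _ hx hy => simp only [mul_add, add_mul]; exact add_mem hx hy
  | smul a x _ hx =>
    simp only [mul_smul_comm, smul_mul_assoc]; exact Submodule.smul_mem _ _ hx

/-- Congruence of `u s m l' v` and `u l m s' v` for disjoint occurrences of principal
monomials. -/
theorem sub_mem_of_disjoint (hT : ∀ f ∈ T, IsMonic f) {s s' : FreeAlg k X} (hs : s ∈ T)
    (hs' : s' ∈ T) {l l' : Word X} (hl : IsLeading s l) (hl' : IsLeading s' l')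
    (u m v : Word X) :
    mono k u * s * mono k (m ++ (l' ++ v)) - mono k (u ++ (l ++ m)) * s' * mono k v ∈
      multSpan T (wordLT · (u ++ l ++ (m ++ (l' ++ v)))) := by
  have a := mul_mem_multSpan_of_mem_wordSpan_right (T := T)
    (Q := (wordLT · (u ++ l ++ (m ++ (l' ++ v))))) hs hl u m v
    (fun q hq => by simpa only [List.append_assoc] using wordLT_append (u ++ l ++ m) v hq.2)
    ((hT s' hs').sub_mem hl')
  have b := mul_mem_multSpan_of_mem_wordSpan_left (T := T)
    (Q := (wordLT · (u ++ l ++ (m ++ (l' ++ v))))) hs' hl' u m v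
    (fun q hq => by simpa only [List.append_assoc] using wordLT_append u (m ++ l' ++ v) hq.2)
    ((hT s hs).sub_mem hl)
  have e := sub_mem b a
  -- On both sides the product `u s m s' v` cancels, leaving only one principal word replaced at a
  -- time.
  have e2 : mono k u * (s - mono k l) * mono k m * s' * mono k v -
      mono k u * s * mono k m * (s' - mono k l') * mono k v =
      mono k u * s * mono k (m ++ (l' ++ v)) - mono k (u ++ (l ++ m)) * s' * mono k v := by
    simp only [← mono_mul_mono, mul_sub, sub_mul, mul_assoc]
    abel
  rwa [e2] at e

theorem IsGSB.composition_mem (hT : IsGSB T) {s s' h : FreeAlg k X} (hs : s ∈ T) (hs' : s' ∈ T)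
    {w : Word X} (hc : IsComposition s s' w h) (u v : Word X) :
    mono k u * h * mono k v ∈ multSpan T (wordLT · (u ++ w ++ v)) :=
  mul_mem_multSpan (P := (wordLT · w)) (Q := (wordLT · (u ++ w ++ v))) u v
    (fun _ hq => wordLT_append u v hq) (isTrivialMod_iff.1 (hT.2 s hs s' hs' w h hc))

theorem IsGSB.sub_mem_of_inclusion (hT : IsGSB T) {s s' : FreeAlg k X} (hs : s ∈ T) (hs' : s' ∈ T)
    {l' a b : Word X} (hl : IsLeading s (a ++ l' ++ b)) (hl' : IsLeading s' l') (u v : Word X) :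
    mono k u * s * mono k v - mono k (u ++ a) * s' * mono k (b ++ v) ∈
      multSpan T (wordLT · (u ++ (a ++ l' ++ b) ++ v)) := by
  have e := hT.composition_mem hs hs' (.inclusion l' a b hl hl') u v
  have e2 : mono k u * (s - mono k a * s' * mono k b) * mono k v =
      mono k u * s * mono k v - mono k (u ++ a) * s' * mono k (b ++ v) := by
    simp only [← mono_mul_mono, mul_sub, sub_mul, mul_assoc]
  rwa [e2] at e

theorem IsGSB.sub_mem_of_intersection (hT : IsGSB T) {s s' : FreeAlg k X} (hs : s ∈ T)
    (hs' : s' ∈ T) {a m b : Word X} (ha : a ≠ []) (hm : m ≠ []) (hb : b ≠ [])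
    (hl : IsLeading s (a ++ m)) (hl' : IsLeading s' (m ++ b)) (u v : Word X) :
    mono k u * s * mono k (b ++ v) - mono k (u ++ a) * s' * mono k v ∈
      multSpan T (wordLT · (u ++ (a ++ m ++ b) ++ v)) := by
  have e := hT.composition_mem hs hs' (.intersection a m b ha hm hb hl hl') u v
  have e2 : mono k u * (s * mono k b - mono k a * s') * mono k v =
      mono k u * s * mono k (b ++ v) - mono k (u ++ a) * s' * mono k v := by
    simp only [← mono_mul_mono, mul_sub, sub_mul, mul_assoc]
  rwa [e2] at e

/-- Here `l` starts first, at distance `t` from `l'`. Either the occurrences are disjoint, or `l'`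
lies inside `l`, or they overlap in a word `m`; the last two are compositions. -/
theorem IsGSB.sub_mem_aux (hT : IsGSB T) {s s' : FreeAlg k X} (hs : s ∈ T) (hs' : s' ∈ T)
    {l l' u v v' t : Word X} (hl : IsLeading s l) (hl' : IsLeading s' l')
    (h : l ++ v = t ++ (l' ++ v')) :
    mono k u * s * mono k v - mono k (u ++ t) * s' * mono k v' ∈
      multSpan T (wordLT · (u ++ l ++ v)) := by
  rcases List.append_eq_append_iff.1 h with ⟨m, rfl, rfl⟩ | ⟨m, rfl, h3⟩
  · exact sub_mem_of_disjoint hT.1 hs hs' hl hl' u m v'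
  · rcases List.append_eq_append_iff.1 h3 with ⟨b, rfl, rfl⟩ | ⟨b, rfl, rfl⟩
    · have e := hT.sub_mem_of_inclusion (a := t) (b := b) hs hs'
        (by simpa using hl) hl' u v
      simpa only [List.append_assoc] using e
    -- An intersection needs three nonempty pieces. For `m` empty the occurrences are adjacent and
    -- so disjoint, for `t` empty `l` is a prefix of `l'`, and for `b` empty `l'` is a suffix of
    -- `l`.
    · by_cases hm : m = []
      · subst hm
        simp only [List.append_nil] at hl ⊢
        simpa using sub_mem_of_disjoint hT.1 hs hs' hl hl' u [] v'
      by_cases ht : t = []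
      · subst ht
        have e := hT.sub_mem_of_inclusion (a := []) hs' hs (by simpa using hl') hl u v'
        rw [← neg_mem_iff]
        simpa using e
      by_cases hb : b = []
      · subst hb
        have e := hT.sub_mem_of_inclusion (b := []) (a := t) hs hs'
          (by simpa using hl) (by simpa using hl') u v'
        simpa using e
      have e := hT.sub_mem_of_intersection hs hs' ht hm hb hl hl' u v'
      simpa only [List.append_assoc] using e

/-- Elements `u s v` and `u' s' v'` with `u s̄ v = u' s̄' v'` are congruent modulo smaller
elements of this form. -/
theorem IsGSB.sub_mem (hT : IsGSB T) {s s' : FreeAlg k X} (hs : s ∈ T) (hs' : s' ∈ T)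
    {l l' u u' v v' w : Word X} (hl : IsLeading s l) (hl' : IsLeading s' l')
    (h : u ++ l ++ v = w) (h' : u' ++ l' ++ v' = w) :
    mono k u * s * mono k v - mono k u' * s' * mono k v' ∈ multSpan T (wordLT · w) := by
  have e : u ++ (l ++ v) = u' ++ (l' ++ v') := by
    rw [← List.append_assoc, h, ← h', List.append_assoc]
  rcases List.append_eq_append_iff.1 e with ⟨t, rfl, h3⟩ | ⟨t, rfl, h3⟩
  · rw [← h]
    exact hT.sub_mem_aux hs hs' hl hl' h3
  · rw [← h', ← neg_mem_iff, neg_sub]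
    exact hT.sub_mem_aux hs' hs hl' hl h3

/-- An element of the span involves finitely many products `u s v`, and the largest of their
principal words serves as `w'`. This makes the descent in `IsGSB.eq_zero` well-founded. -/
theorem exists_mem_multSpan_le {w : Word X} {f : FreeAlg k X} (hf : f ∈ multSpan T (wordLT · w)) :
    f = 0 ∨ ∃ w', wordLT w' w ∧ f ∈ multSpan T (fun q => q = w' ∨ wordLT q w') := by
  induction hf using Submodule.span_induction with
  | mem x hx =>
    obtain ⟨s, hs, l, u, v, hl, hp, rfl⟩ := hx
    exact .inr ⟨_, hp, mem_multSpan hs hl (.inl rfl)⟩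
  | zero => exact .inl rfl
  | add x y _ _ hx hy =>
    rcases hx with rfl | ⟨w₁, h₁, hx⟩
    · simpa using hy
    rcases hy with rfl | ⟨w₂, h₂, hy⟩
    · rw [add_zero]; exact .inr ⟨w₁, h₁, hx⟩
    rcases wordLT_trichotomy w₁ w₂ with h | rfl | h
    · refine .inr ⟨w₂, h₂, add_mem (multSpan_mono subset_rfl ?_ hx) hy⟩
      rintro q (rfl | hq)
      exacts [.inr h, .inr (wordLT_trans hq h)]
    · exact .inr ⟨w₁, h₁, add_mem hx hy⟩
    · refine .inr ⟨w₁, h₁, add_mem hx (multSpan_mono subset_rfl ?_ hy)⟩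
      rintro q (rfl | hq)
      exacts [.inr h, .inr (wordLT_trans hq h)]
  | smul a x _ hx =>
    rcases hx with rfl | ⟨w₁, h₁, hx⟩
    · exact .inl (smul_zero _)
    · exact .inr ⟨w₁, h₁, Submodule.smul_mem _ _ hx⟩

theorem exists_mem_multSpan_lt [WellFoundedLT X] {f : FreeAlg k X}
    (hf : f ∈ multSpan T fun _ => True) :
    f = 0 ∨ ∃ w, f ∈ multSpan T (fun q => q = w ∨ wordLT q w) := by
  induction hf using Submodule.span_induction with
  | mem x hx =>
    obtain ⟨s, hs, l, u, v, hl, hp, rfl⟩ := hx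
    exact .inr ⟨_, mem_multSpan hs hl (.inl rfl)⟩
  | zero => exact .inl rfl
  | add x y _ _ hx hy =>
    rcases hx with rfl | ⟨w₁, hx⟩
    · simpa using hy
    rcases hy with rfl | ⟨w₂, hy⟩
    · rw [add_zero]; exact .inr ⟨w₁, hx⟩
    rcases wordLT_trichotomy w₁ w₂ with h | rfl | h
    · refine .inr ⟨w₂, add_mem (multSpan_mono subset_rfl ?_ hx) hy⟩
      rintro q (rfl | hq)
      exacts [.inr h, .inr (wordLT_trans hq h)]
    · exact .inr ⟨w₁, add_mem hx hy⟩
    · refine .inr ⟨w₁, add_mem hx (multSpan_mono subset_rfl ?_ hy)⟩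
      rintro q (rfl | hq)
      exacts [.inr h, .inr (wordLT_trans hq h)]
  | smul a x _ hx =>
    rcases hx with rfl | ⟨w₁, hx⟩
    · exact .inl (smul_zero _)
    · exact .inr ⟨w₁, Submodule.smul_mem _ _ hx⟩

/-- `w` contains no principal monomial of an element of `T`. -/
def AvoidsLeading (T : Set (FreeAlg k X)) (w : Word X) : Prop :=
  ∀ s ∈ T, ∀ l u v : Word X, IsLeading s l → w ≠ u ++ l ++ v

/-- Elements of the ideal generated by a Gröbner–Shirshov basis contain reducible words. -/
theorem IsGSB.eq_zero [WellFoundedLT X] (hT : IsGSB T) {f : FreeAlg k X}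
    (hf : f ∈ multSpan T fun _ => True)
    (hr : ∀ w, f.coeff (FreeMonoid.ofList w) ≠ 0 → AvoidsLeading T w) : f = 0 := by
  classical
  rcases exists_mem_multSpan_lt hf with h | ⟨w, hw⟩
  · exact h
  clear hf
  revert hw
  -- The induction is on an upper bound `w` for the principal words in a presentation of `f`, not on
  -- the principal word of `f`, as cancellation may occur at the top.
  refine wordLT_wellFounded.induction
    (C := fun w => f ∈ multSpan T (fun q => q = w ∨ wordLT q w) → f = 0) w fun w ih hw => ?_
  · by_cases hex : ∃ s ∈ T, ∃ l u v : Word X, IsLeading s l ∧ u ++ l ++ v = w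
    · obtain ⟨s, hs, l, u, v, hl, hw'⟩ := hex
      set g := mono k u * s * mono k v with hg
      -- All summands whose principal word is exactly `w` are congruent to multiples of the single
      -- element `g`, by `IsGSB.sub_mem`.
      have key : ∃ a : k, f - a • g ∈ multSpan T (wordLT · w) := by
        clear hr ih
        induction hw using Submodule.span_induction with
        | mem x hx =>
          obtain ⟨s', hs', l', u', v', hl', hp, rfl⟩ := hx
          rcases hp with hp | hp
          · exact ⟨1, by rw [one_smul]; exact hT.sub_mem hs' hs hl' hl hp hw'⟩
          · exact ⟨0, by rw [zero_smul, sub_zero]; exact mem_multSpan hs' hl' hp⟩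
        | zero => exact ⟨0, by simp⟩
        | add x y hx' hy' hx hy =>
          obtain ⟨a, ha⟩ := hx
          obtain ⟨b, hb⟩ := hy
          refine ⟨a + b, ?_⟩
          have e : x + y - (a + b) • g = (x - a • g) + (y - b • g) := by module
          rw [e]; exact add_mem ha hb
        | smul c x hx' hx =>
          obtain ⟨a, ha⟩ := hx
          refine ⟨c * a, ?_⟩
          have e : c • x - (c * a) • g = c • (x - a • g) := by module
          rw [e]; exact Submodule.smul_mem _ _ ha
      obtain ⟨a, ha⟩ := key
      have hgw : g.coeff (FreeMonoid.ofList w) = 1 := by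
        have e := mul_mem_wordSpan (Q := (wordLT · w)) u v
          (fun q hq => by rw [← hw']; exact wordLT_append u v hq.2) ((hT.1 s hs).sub_mem hl)
        rw [mul_sub, sub_mul, mono_mul_mono, mono_mul_mono, hw'] at e
        exact (isLeading_of_sub_mem e).2
      -- The reducible word `w` cannot occur in `f`, while it occurs in `g` with coefficient one and
      -- not in `f - a • g`. So `a = 0`, and the bound on `f` drops below `w`.
      have hfw : f.coeff (FreeMonoid.ofList w) = 0 := by
        by_contra h
        exact hr w h s hs l u v hl hw'.symm
      have e := coeff_of_mem_wordSpan (multSpan_le_wordSpan hT.1 w ha) (wordLT_irrefl w)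
      simp only [MonoidAlgebra.coeff_sub, MonoidAlgebra.coeff_smul, Finsupp.sub_apply,
        Finsupp.smul_apply, hfw, hgw, smul_eq_mul, mul_one, zero_sub, neg_eq_zero] at e
      rw [e, zero_smul, sub_zero] at ha
      rcases exists_mem_multSpan_le ha with h | ⟨w', hw1, hw2⟩
      · exact h
      · exact ih w' hw1 hw2
    · have ha : f ∈ multSpan T (wordLT · w) := by
        refine Submodule.span_mono ?_ hw
        rintro _ ⟨s, hs, l, u, v, hl, hp | hp, rfl⟩
        · exact absurd ⟨s, hs, l, u, v, hl, hp⟩ hex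
        · exact ⟨s, hs, l, u, v, hl, hp, rfl⟩
      rcases exists_mem_multSpan_le ha with h | ⟨w', hw1, hw2⟩
      · exact h
      · exact ih w' hw1 hw2

end Diamond

/-! ### Identities in associative conformal algebras -/

/-- Pascal's rule for sums. -/
theorem sum_choose_succ_smul {M : Type*} [AddCommMonoid M] (f : ℕ → ℕ → M) (n : ℕ) :
    ∑ s ∈ Finset.range (n + 2), (n + 1).choose s • f (n + 1 - s) s =
      ∑ s ∈ Finset.range (n + 1), n.choose s • (f (n + 1 - s) s + f (n - s) (s + 1)) := by
  have h := Finset.sum_range_succ' (fun s => (n + 1).choose s • f (n + 1 - s) s) (n + 1)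
  simp only [Nat.choose_succ_succ, add_smul, Nat.add_sub_add_right, Finset.sum_add_distrib] at h
  rw [h]
  simp only [smul_add, Finset.sum_add_distrib]
  rw [Finset.sum_range_succ (fun s => n.choose (s + 1) • f (n - s) (s + 1)), Nat.choose_succ_self,
    zero_smul, add_zero, Finset.sum_range_succ' (fun s => n.choose s • f (n + 1 - s) s)]
  simp only [Nat.choose_zero_right, Nat.add_sub_add_right]
  abel

/-- Binomial inversion. -/
theorem sum_choose_inversion {M : Type*} [AddCommGroup M] (n : ℕ) : ∀ (F : ℕ → ℕ → M) (m : ℕ),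
    ∑ q ∈ Finset.range (n + 1), n.choose q • ((-1 : ℤ) ^ q •
      ∑ s ∈ Finset.range (n - q + 1), (n - q).choose s • F (n - q - s) (m + q + s)) = F n m := by
  -- Symbolically, with `F i j = x^i y^j`, the claim is `((x + y) - y)^n y^m = x^n y^m`; Pascal's
  -- rule in both sums gives the inductive step.
  induction n with
  | zero => intro F m; simp
  | succ n ih =>
    intro F m
    have h := sum_choose_succ_smul (fun i j => (-1 : ℤ) ^ j •
      ∑ s ∈ Finset.range (i + 1), i.choose s • F (i - s) (m + j + s)) n
    rw [h, ← ih (fun i j => F (i + 1) j) m]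
    refine Finset.sum_congr rfl fun q hq => ?_
    have hq' : q ≤ n := by simpa [Nat.lt_succ_iff] using hq
    congr 1
    have e : n + 1 - q = n - q + 1 := by omega
    have h2 := sum_choose_succ_smul (fun i j => F i (m + q + j)) (n - q)
    rw [e, h2]
    simp only [smul_add, Finset.sum_add_distrib, pow_succ, mul_neg, mul_one, neg_smul]
    have e2 : ∀ x, m + (q + 1) + x = m + q + (x + 1) := fun x => by ring
    simp only [e2, add_neg_cancel_right]
    congr 1
    refine Finset.sum_congr rfl fun s hs => ?_
    have hs' : s ≤ n - q := by simpa [Nat.lt_succ_iff] using hs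
    rw [show n - q + 1 - s = n - q - s + 1 by omega]

section Identities

variable (k : Type v) {C : Type w} [Field k] [AddCommGroup C] [Module k C] [ConformalOps k C]

/-- `D^(s) = D^s / s!`. -/
noncomputable def dDiv (s : ℕ) : C →ₗ[k] C := (s.factorial : k)⁻¹ • (D k) ^ s

theorem D_dDiv [CharZero k] (s : ℕ) (a : C) :
    D k (dDiv k s a) = (s + 1) • dDiv k (s + 1) a := by
  have h : ((s : k) + 1) ≠ 0 := by exact_mod_cast Nat.succ_ne_zero s
  have h' : (s.factorial : k) ≠ 0 := by exact_mod_cast s.factorial_ne_zero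
  rw [dDiv, dDiv, LinearMap.smul_apply, LinearMap.smul_apply, map_smul, pow_succ',
    Module.End.mul_apply, ← Nat.cast_smul_eq_nsmul k, smul_smul, Nat.factorial_succ]
  congr 1
  push_cast
  field_simp

theorem dDiv_zero (a : C) : dDiv k 0 a = a := by simp [dDiv]

/-- A summand of `R_n^b z`. -/
noncomputable def rTerm (n s : ℕ) (b : C) : C →ₗ[k] C :=
  (-1 : ℤ) ^ (n + s) • (dDiv k s ∘ₗ (mul k (n + s)).flip b)

theorem rTerm_apply (n s : ℕ) (b z : C) :
    rTerm k n s b z = (-1 : ℤ) ^ (n + s) • dDiv k s (mul k (n + s) z b) := rfl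

theorem rTerm_eq_zero {b z : C} {M : ℕ} (h : ∀ m, M ≤ m → mul k m z b = 0) {n s : ℕ}
    (hs : M ≤ n + s) : rTerm k n s b z = 0 := by
  rw [rTerm_apply, h _ hs, map_zero, smul_zero]

/-- The freedom in the choice of `B` allows sums belonging to different elements to be compared over
a common range. -/
theorem finsum_rTerm {b z : C} {M : ℕ} (h : ∀ m, M ≤ m → mul k m z b = 0) {n B : ℕ}
    (hB : M ≤ n + B) :
    ∑ᶠ s, rTerm k n s b z = ∑ s ∈ Finset.range B, rTerm k n s b z := by
  refine finsum_eq_sum_of_support_subset _ fun s hs => ?_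
  by_contra hs'
  refine hs (rTerm_eq_zero k h ?_)
  simp only [Finset.coe_range, Set.mem_Iio, not_lt] at hs'
  omega

variable [IsAssocConformal k C]

/-- Binomial inversion of the associativity axiom. With `a (n) b = 0` the right-hand side is the
source of the third family of relations in `Σ(X,N)`. -/
theorem mul_mul_eq (n m : ℕ) (a b c : C) : mul k m (mul k n a b) c =
    ∑ q ∈ Finset.range (n + 1), n.choose q • ((-1 : ℤ) ^ q •
      mul k (n - q) a (mul k (m + q) b c)) := by
  rw [← sum_choose_inversion n (fun i j => mul k j (mul k i a b) c) m]
  simp only [IsAssocConformal.assoc]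

/-- `a (n) D^(t) b = ∑ j, binom n j D^(t-j) (a (n-j) b)`. -/
theorem mul_dDiv [CharZero k] (a b : C) (t : ℕ) : ∀ n : ℕ, mul k n a (dDiv k t b) =
    ∑ j ∈ Finset.range (t + 1), n.choose j • dDiv k (t - j) (mul k (n - j) a b) := by
  induction t with
  | zero => intro n; simp [dDiv_zero]
  | succ t ih =>
    intro n
    have ht : (((t + 1 : ℕ) : k)) ≠ 0 := by exact_mod_cast Nat.succ_ne_zero t
    -- After multiplication by `t + 1`, the element `(t + 1) D^(t+1) b` becomes `D (D^(t) b)`, to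
    -- which `mul_D` and the induction hypothesis apply.
    refine (smul_right_injective C ht) ?_
    simp only [Nat.cast_smul_eq_nsmul]
    rw [← map_nsmul, ← D_dDiv, IsAssocConformal.mul_D, ih, ih, map_sum, Finset.smul_sum,
      Finset.smul_sum]
    have e1 : ∑ j ∈ Finset.range (t + 1), D k (n.choose j • dDiv k (t - j) (mul k (n - j) a b)) =
        ∑ j ∈ Finset.range (t + 2), ((t + 1 - j) * n.choose j) •
          dDiv k (t + 1 - j) (mul k (n - j) a b) := by
      rw [Finset.sum_range_succ _ (t + 1)]
      simp only [Nat.sub_self, zero_mul, zero_smul, add_zero]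
      refine Finset.sum_congr rfl fun j hj => ?_
      have hj' : j ≤ t := by simpa [Nat.lt_succ_iff] using hj
      rw [map_nsmul, D_dDiv, smul_smul, show t + 1 - j = t - j + 1 by omega, mul_comm]
    -- By `n * binom (n-1) j = (j+1) * binom n (j+1)` the second sum carries the weight `j`,
    -- complementing the weight `t + 1 - j` of the first to `t + 1`.
    have e2 : ∑ j ∈ Finset.range (t + 1), n • ((n - 1).choose j •
          dDiv k (t - j) (mul k (n - 1 - j) a b)) =
        ∑ j ∈ Finset.range (t + 2), (j * n.choose j) •
          dDiv k (t + 1 - j) (mul k (n - j) a b) := by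
      rw [Finset.sum_range_succ' _ (t + 1)]
      simp only [zero_mul, zero_smul, add_zero, Nat.add_sub_add_right]
      refine Finset.sum_congr rfl fun j _ => ?_
      rcases n with _ | n
      · simp
      · rw [smul_smul, Nat.add_sub_cancel, Nat.add_one_mul_choose_eq, Nat.add_sub_add_right,
          mul_comm]
    rw [e1, e2, ← Finset.sum_add_distrib]
    refine Finset.sum_congr rfl fun j hj => ?_
    have hj' : j ≤ t + 1 := by simpa [Nat.lt_succ_iff] using hj
    rw [← add_smul, ← add_mul, Nat.sub_add_cancel hj', smul_smul]

/-- The operator `R_n^b` of right multiplication,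
`R_n^b z = ∑ s, (-1)^(n+s) D^(s) (z (n+s) b)`. -/
noncomputable def rOp (n : ℕ) (b : C) : C →ₗ[k] C where
  toFun z := ∑ᶠ s, rTerm k n s b z
  map_add' y z := by
    obtain ⟨M, hM⟩ := IsAssocConformal.locality (k := k) y b
    obtain ⟨M', hM'⟩ := IsAssocConformal.locality (k := k) z b
    have h : ∀ m, M + M' ≤ m → mul k m (y + z) b = 0 := fun m hm => by
      rw [map_add, LinearMap.add_apply, hM m (by omega), hM' m (by omega), add_zero]
    rw [finsum_rTerm k h (B := M + M') (by omega), finsum_rTerm k hM (B := M + M') (by omega),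
      finsum_rTerm k hM' (B := M + M') (by omega), ← Finset.sum_add_distrib]
    simp only [map_add]
  map_smul' c z := by
    obtain ⟨M, hM⟩ := IsAssocConformal.locality (k := k) z b
    have h : ∀ m, M ≤ m → mul k m (c • z) b = 0 := fun m hm => by
      rw [map_smul, LinearMap.smul_apply, hM m hm, smul_zero]
    rw [finsum_rTerm k h (B := M) (by omega), finsum_rTerm k hM (B := M) (by omega)]
    simp only [map_smul, Finset.smul_sum, RingHom.id_apply]

theorem rOp_eq_sum {b z : C} {M : ℕ} (h : ∀ m, M ≤ m → mul k m z b = 0) {n B : ℕ}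
    (hB : M ≤ n + B) :
    rOp k n b z = ∑ s ∈ Finset.range B, (-1 : ℤ) ^ (n + s) • dDiv k s (mul k (n + s) z b) :=
  finsum_rTerm k h hB

/-- The factor `n + s` produced by `D_mul` splits: its part `s` is absorbed by `D D^(s-1) = s D^(s)`
and gives `D R_n`, its part `n` gives `n R_{n-1}`. -/
theorem rOp_D [CharZero k] (n : ℕ) (b z : C) :
    rOp k n b (D k z) = D k (rOp k n b z) + n • rOp k (n - 1) b z := by
  obtain ⟨M, hM⟩ := IsAssocConformal.locality (k := k) z b
  have h : ∀ m, M + 1 ≤ m → mul k m (D k z) b = 0 := fun m hm => by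
    rw [IsAssocConformal.D_mul, hM _ (by omega), smul_zero, neg_zero]
  rw [rOp_eq_sum k h (B := M + 2) (by omega), rOp_eq_sum k hM (B := M + 1) (by omega),
    rOp_eq_sum k hM (B := M + 2) (by omega), map_sum, Finset.smul_sum]
  have e1 : ∑ s ∈ Finset.range (M + 1), D k ((-1 : ℤ) ^ (n + s) • dDiv k s (mul k (n + s) z b)) =
      ∑ s ∈ Finset.range (M + 2),
        s • ((-1 : ℤ) ^ (n + s + 1) • dDiv k s (mul k (n + s - 1) z b)) := by
    rw [Finset.sum_range_succ' _ (M + 1)]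
    simp only [zero_smul, add_zero]
    refine Finset.sum_congr rfl fun s _ => ?_
    rw [map_zsmul, D_dDiv, smul_comm]
    congr 2
    simp [pow_succ, ← add_assoc]
  rw [e1, ← Finset.sum_add_distrib]
  refine Finset.sum_congr rfl fun s _ => ?_
  rw [IsAssocConformal.D_mul, map_neg, map_nsmul, pow_succ, mul_neg, mul_one, add_smul]
  rcases n with _ | n
  · simp only [zero_smul, add_zero, zero_add]
    rw [neg_smul, smul_neg, smul_neg, smul_comm]
  · rw [show n + 1 + s - 1 = n + s by omega, Nat.add_sub_cancel,
      show n + 1 + s = n + s + 1 by omega, pow_succ]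
    simp only [mul_neg, mul_one, neg_neg, neg_smul, smul_neg]
    rw [smul_add, add_comm, smul_comm, smul_comm s, smul_comm (n + 1)]

theorem rOp_mul [CharZero k] (m n : ℕ) (a b z : C) :
    rOp k m b (mul k n a z) = mul k n a (rOp k m b z) := by
  obtain ⟨M, hM⟩ := IsAssocConformal.locality (k := k) z b
  have h : ∀ j, M ≤ j → mul k j (mul k n a z) b = 0 := fun j hj => by
    rw [mul_mul_eq]
    exact Finset.sum_eq_zero fun q _ => by rw [hM _ (by omega), map_zero, smul_zero, smul_zero]
  set B := M + n + 1 with hB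
  rw [rOp_eq_sum k h (B := B) (by omega), rOp_eq_sum k hM (B := B) (by omega), map_sum]
  -- In the common term `f j i`, the index `i` counts derivatives and `j` counts how far the order
  -- `n` is lowered. One side sums `f` over the square of side `B`, the other over the triangle `i +
  -- j < B`.
  let f : ℕ → ℕ → C := fun j i => (-1 : ℤ) ^ (m + i + j) • n.choose j •
    dDiv k i (mul k (n - j) a (mul k (m + i + j) z b))
  have hr : ∑ s ∈ Finset.range B, mul k n a ((-1 : ℤ) ^ (m + s) • dDiv k s (mul k (m + s) z b)) =
      ∑ s ∈ Finset.range B, ∑ j ∈ Finset.range (s + 1), f j (s - j) := by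
    refine Finset.sum_congr rfl fun s _ => ?_
    rw [map_zsmul, mul_dDiv, Finset.smul_sum]
    refine Finset.sum_congr rfl fun j hj => ?_
    have hj' : j ≤ s := by simpa [Nat.lt_succ_iff] using hj
    simp only [f, show m + (s - j) + j = m + s by omega]
  rw [hr, Finset.sum_range_diag_flip]
  have hl : ∑ s ∈ Finset.range B, (-1 : ℤ) ^ (m + s) • dDiv k s (mul k (m + s) (mul k n a z) b) =
      ∑ s ∈ Finset.range B, ∑ j ∈ Finset.range B, f j s := by
    refine Finset.sum_congr rfl fun s _ => ?_
    rw [mul_mul_eq, map_sum, Finset.smul_sum]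
    have hsub : Finset.range (n + 1) ⊆ Finset.range B := Finset.range_mono (by omega)
    rw [← Finset.sum_subset hsub]
    · refine Finset.sum_congr rfl fun j _ => ?_
      simp only [f, map_nsmul, map_zsmul]
      rw [pow_add _ (m + s) j, mul_smul, smul_comm (n.choose j) ((-1 : ℤ) ^ j)]
    · intro j _ hj
      have : n < j := by simpa [Nat.lt_succ_iff] using hj
      simp [f, Nat.choose_eq_zero_of_lt this]
  rw [hl, Finset.sum_comm]
  refine Finset.sum_congr rfl fun j _ => ?_
  rw [← Finset.sum_subset (Finset.range_mono (Nat.sub_le B j))]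
  -- Outside the triangle the product of `z` and `b` has order `m + i + j ≥ B ≥ M`, so it vanishes
  -- by locality.
  intro i _ hi
  have : B - j ≤ i := by simpa using hi
  simp only [f]
  rw [hM _ (by omega), map_zero, map_zero, smul_zero, smul_zero]

end Identities

/-! ### The conformal algebra of sequences of operators -/

section Sequences

variable {k : Type v} [Field k] {V : Type w} [AddCommGroup V] [Module k V]

/-- The shift of sequences. -/
def shift (k : Type v) [Field k] {V : Type w} [AddCommGroup V] [Module k V] :
    (ℕ → Module.End k V) →ₗ[k] (ℕ → Module.End k V) :=
  LinearMap.funLeft k (Module.End k V) Nat.succ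

/-- The products of sequences, corresponding to `Res_w (w - z)^m φ(w) ψ(z)` for formal
distributions. -/
def seqMul (k : Type v) [Field k] {V : Type w} [AddCommGroup V] [Module k V] :
    ℕ → (ℕ → Module.End k V) →ₗ[k] (ℕ → Module.End k V) →ₗ[k] (ℕ → Module.End k V)
  | 0 => LinearMap.mk₂ k (fun φ ψ n => φ 0 * ψ n)
      (fun _ _ _ => by ext; simp [add_mul]) (fun _ _ _ => by ext; simp)
      (fun _ _ _ => by ext; simp [mul_add]) (fun _ _ _ => by ext; simp)
  | m + 1 => (seqMul k m).comp (shift k) - (seqMul k m).compl₂ (shift k)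

/-- A sequence stands for the modes of `∑ φ n z^(-n-1)`: the operation `∂` is the derivative in `z`,
and `shift` is multiplication by `z`. Locality may fail for arbitrary sequences, which is why
`exists_lift` does not ask for it. -/
instance seqOps : ConformalOps k (ℕ → Module.End k V) where
  dMap :=
    { toFun := fun φ n => -(n • φ (n - 1))
      map_add' := fun φ ψ => by ext n; simp only [Pi.add_apply, smul_add]; abel_nf
      map_smul' := fun c φ => by
        ext n; simp only [Pi.smul_apply, RingHom.id_apply, smul_neg, smul_comm n c] }
  nMul := seqMul k

theorem seq_D_apply (φ : ℕ → Module.End k V) (n : ℕ) : D k φ n = -(n • φ (n - 1)) := rfl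

theorem seq_mul_zero (φ ψ : ℕ → Module.End k V) (n : ℕ) : mul k 0 φ ψ n = φ 0 * ψ n := rfl

theorem seq_mul_succ (m : ℕ) (φ ψ : ℕ → Module.End k V) :
    mul k (m + 1) φ ψ = mul k m (shift k φ) ψ - mul k m φ (shift k ψ) := rfl

theorem shift_apply (φ : ℕ → Module.End k V) (n : ℕ) : shift k φ n = φ (n + 1) := rfl

theorem shift_D (φ : ℕ → Module.End k V) : shift k (D k φ) = D k (shift k φ) - φ := by
  ext n
  rcases n with _ | n
  · simp [shift_apply, seq_D_apply]
  · simp only [shift_apply, seq_D_apply, Pi.sub_apply, Nat.add_sub_cancel]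
    rw [add_smul (n + 1), one_smul]; abel_nf

/-- The index of the result enters `seqMul` only through the second factor. -/
theorem shift_mul (m : ℕ) : ∀ φ ψ : ℕ → Module.End k V,
    shift k (mul k m φ ψ) = mul k m φ (shift k ψ) := by
  induction m with
  | zero => intro φ ψ; rfl
  | succ m ih => intro φ ψ; simp only [seq_mul_succ, map_sub, ih]

theorem seq_D_mul (n : ℕ) : ∀ φ ψ : ℕ → Module.End k V,
    mul k n (D k φ) ψ = -(n • mul k (n - 1) φ ψ) := by
  induction n with
  | zero => intro φ ψ; ext i; simp [seq_mul_zero, seq_D_apply]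
  | succ n ih =>
    intro φ ψ
    rw [seq_mul_succ, shift_D, map_sub, LinearMap.sub_apply, ih, ih, Nat.add_sub_cancel, add_smul,
      one_smul]
    rcases n with _ | n
    · simp
    · rw [Nat.add_sub_cancel, seq_mul_succ, smul_sub]; abel

theorem seq_mul_D (n : ℕ) : ∀ φ ψ : ℕ → Module.End k V,
    mul k n φ (D k ψ) = D k (mul k n φ ψ) + n • mul k (n - 1) φ ψ := by
  induction n with
  | zero =>
    intro φ ψ
    ext1 i
    simp only [zero_smul, add_zero, seq_mul_zero, seq_D_apply, mul_neg, mul_smul_comm]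
  | succ n ih =>
    intro φ ψ
    rw [seq_mul_succ, shift_D, map_sub, ih, ih, seq_mul_succ, map_sub, Nat.add_sub_cancel, add_smul,
      one_smul]
    rcases n with _ | n
    · simp; abel_nf
    · rw [Nat.add_sub_cancel, seq_mul_succ n φ ψ, smul_sub, seq_mul_succ n (shift k φ)]
      abel_nf

/-- Symbolically this is `(w - z)^n = ((w - y) + (y - z))^n`. The recursion for the products
supplies one factor at a time, matched by Pascal's rule. -/
theorem seq_assoc (n : ℕ) : ∀ (m : ℕ) (φ ψ χ : ℕ → Module.End k V), mul k n φ (mul k m ψ χ) =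
    ∑ s ∈ Finset.range (n + 1), n.choose s • mul k (m + s) (mul k (n - s) φ ψ) χ := by
  induction n with
  | zero =>
    intro m
    simp only [zero_add, Finset.range_one, Finset.sum_singleton, Nat.choose_self, one_smul,
      add_zero, Nat.sub_self]
    induction m with
    | zero => intro φ ψ χ; ext i; simp [seq_mul_zero, mul_assoc]
    | succ m ih => intro φ ψ χ; rw [seq_mul_succ, seq_mul_succ, map_sub, ih, ih, shift_mul]
  | succ n ih =>
    intro m φ ψ χ
    rw [sum_choose_succ_smul (fun i s => mul k (m + s) (mul k i φ ψ) χ) n, seq_mul_succ,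
      shift_mul, ih, ih, ← Finset.sum_sub_distrib]
    refine Finset.sum_congr rfl fun s hs => ?_
    have hs' : s ≤ n := by simpa [Nat.lt_succ_iff] using hs
    rw [← smul_sub, show n + 1 - s = n - s + 1 by omega, seq_mul_succ (n - s), ← add_assoc,
      seq_mul_succ (m + s), shift_mul, map_sub, LinearMap.sub_apply]
    congr 1
    abel

end Sequences

/-- The universal property of `Conf k N` without assuming locality of all elements. -/
theorem exists_lift {k : Type v} [Field k] {X : Type u} (N : X → X → ℕ) {C : Type w}
    [AddCommGroup C] [Module k C] [ConformalOps k C]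
    (hDm : ∀ (n : ℕ) (a b : C), mul k n (D k a) b = -(n • mul k (n - 1) a b))
    (hmD : ∀ (n : ℕ) (a b : C), mul k n a (D k b) = D k (mul k n a b) + n • mul k (n - 1) a b)
    (has : ∀ (n m : ℕ) (a b c : C), mul k n a (mul k m b c) =
      ∑ s ∈ Finset.range (n + 1), n.choose s • mul k (m + s) (mul k (n - s) a b) c)
    (f : X → C) (hf : ∀ (a b : X) (n : ℕ), N a b ≤ n → mul k n (f a) (f b) = 0) :
    ∃ φ : Conf k N →ₗ[k] C, (∀ x, φ (gen k N x) = f x) ∧ (∀ a, φ (D k a) = D k (φ a)) ∧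
      ∀ n a b, φ (mul k n a b) = mul k n (φ a) (φ b) := by
  let e : TermAlg k X →ₗ[k] C := Finsupp.linearCombination k (Term.eval k f)
  have eD : ∀ a, e (D k a) = D k (e a) := by
    intro a
    induction a using Finsupp.induction_linear with
    | zero => simp
    | add p q hp hq => simp only [map_add, hp, hq]
    | single t c => simp [e, D_single, Term.eval]
  have emul : ∀ n a b, e (mul k n a b) = mul k n (e a) (e b) := by
    intro n a b
    induction a using Finsupp.induction_linear with
    | zero => simp
    | add p q hp hq => simp only [map_add, LinearMap.add_apply, hp, hq]
    | single t c =>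
      induction b using Finsupp.induction_linear with
      | zero => simp
      | add p q hp hq => simp only [map_add, hp, hq]
      | single s c' =>
        rw [mul_single]
        simp only [e, Finsupp.linearCombination_single, Term.eval, map_smul, LinearMap.smul_apply,
          smul_smul, mul_comm]
  have hker : ideal k {r | Relation k N r} ≤ LinearMap.ker e := by
    refine ideal_le k ⟨fun a ha => ?_, fun n a b hb => ?_, fun n a b ha => ?_⟩ ?_
    · rw [LinearMap.mem_ker] at ha ⊢
      rw [eD, ha, map_zero]
    · rw [LinearMap.mem_ker] at hb ⊢
      rw [emul, hb, map_zero]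
    · rw [LinearMap.mem_ker] at ha ⊢
      rw [emul, ha, map_zero, LinearMap.zero_apply]
    · intro r hr
      change e r = 0
      cases hr with
      | D_mul n a b => rw [map_add, map_nsmul, emul, emul, eD, hDm, neg_add_cancel]
      | mul_D n a b => simp only [map_sub, map_add, map_nsmul, emul, eD, hmD, sub_self]
      | assoc n m a b c =>
        rw [map_sub, sub_eq_zero, map_sum, emul, emul, has]
        simp only [map_nsmul, emul]
      | locality a b n hn => simpa [emul, e, Term.eval] using hf a b n hn
  refine ⟨Submodule.liftQ _ e hker, fun x => ?_, fun a => ?_, fun n a b => ?_⟩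
  · simp [gen, e, Term.eval]
  · obtain ⟨a, rfl⟩ := (ideal k {r | Relation k N r}).mkQ_surjective a
    exact eD a
  · obtain ⟨a, rfl⟩ := (ideal k {r | Relation k N r}).mkQ_surjective a
    obtain ⟨b, rfl⟩ := (ideal k {r | Relation k N r}).mkQ_surjective b
    exact emul n a b

/-! ### Linear independence of the normal words in `Conf k N` -/

section Model

variable (k : Type v) [Field k] {X : Type u} (N : X → X → ℕ)

/-- The space of words in the derivatives `a^(i)` of the generators `a`, with `(i, a)` standing
for `a^(i)`. -/
abbrev DiffSpace (k : Type v) [Field k] (X : Type u) : Type (max u v) := List (ℕ × X) →₀ k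

/-- The product `a^(i) w`, which is zero if `w` begins with `b^(n)` and `n ≥ N a b`. -/
noncomputable def diffCons (i : ℕ) (a : X) : List (ℕ × X) → DiffSpace k X
  | [] => Finsupp.single [(i, a)] 1
  | (n, b) :: w => if n < N a b then Finsupp.single ((i, a) :: (n, b) :: w) 1 else 0

/-- Multiplication by `a^(i)` on the left. -/
noncomputable def diffMul (i : ℕ) (a : X) : Module.End k (DiffSpace k X) :=
  Finsupp.linearCombination k (diffCons k N i a)

/-- The derivative of a word. -/
noncomputable def diffWord : List (ℕ × X) → DiffSpace k X
  | [] => 0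
  | (i, a) :: w => Finsupp.single ((i + 1, a) :: w) 1 + diffMul k N i a (diffWord w)

/-- The derivation. -/
noncomputable def diffD : Module.End k (DiffSpace k X) :=
  Finsupp.linearCombination k (diffWord k N)

theorem diffMul_single (i : ℕ) (a : X) (w : List (ℕ × X)) :
    diffMul k N i a (Finsupp.single w 1) = diffCons k N i a w := by
  simp [diffMul]

theorem diffD_single (w : List (ℕ × X)) :
    diffD k N (Finsupp.single w 1) = diffWord k N w := by
  simp [diffD]

theorem diffMul_diffMul (i n : ℕ) (a b : X) (h : N a b ≤ n) :
    diffMul k N i a * diffMul k N n b = 0 := by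
  ext w : 2
  simp only [LinearMap.comp_apply, Finsupp.lsingle_apply, Module.End.mul_apply, diffMul_single,
    LinearMap.zero_apply]
  rcases w with _ | ⟨⟨m, c⟩, w⟩
  · rw [diffCons, diffMul_single, diffCons, if_neg (by omega)]
  · rw [diffCons]
    split_ifs
    · rw [diffMul_single, diffCons, if_neg (by omega)]
    · rw [map_zero]

/-- The Leibniz rule holds for vanishing products too: the condition `n ≥ N a b` for `a^(i) b^(n) =
0` survives raising either `i` or `n`. -/
theorem diffD_diffMul (i : ℕ) (a : X) :
    diffD k N * diffMul k N i a = diffMul k N (i + 1) a + diffMul k N i a * diffD k N := by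
  ext w : 2
  simp only [LinearMap.comp_apply, Finsupp.lsingle_apply, Module.End.mul_apply, diffMul_single,
    LinearMap.add_apply, diffD_single]
  rcases w with _ | ⟨⟨n, b⟩, w⟩
  · simp only [diffCons, diffD_single, diffWord]
  · by_cases h : n < N a b
    · rw [diffCons, if_pos h, diffCons, if_pos h, diffD_single, diffWord]
    · have e : diffMul k N i a (diffMul k N n b (diffWord k N w)) = 0 :=
        LinearMap.congr_fun (diffMul_diffMul k N i n a b (by omega)) (diffWord k N w)
      rw [diffCons, if_neg h, diffCons, if_neg h, map_zero, diffWord, map_add, e, diffMul_single,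
        diffCons, if_neg (by omega), add_zero, add_zero]

/-- The commutator with the derivation. -/
noncomputable def diffAd (E : Module.End k (DiffSpace k X)) : Module.End k (DiffSpace k X) :=
  diffD k N * E - E * diffD k N

theorem diffAd_iterate_mul (m : ℕ) (E : Module.End k (DiffSpace k X)) :
    (diffAd k N)^[m] (E * diffD k N) = (diffAd k N)^[m] E * diffD k N := by
  induction m with
  | zero => rfl
  | succ m ih =>
    rw [Function.iterate_succ_apply', ih, Function.iterate_succ_apply', diffAd, diffAd]
    refine LinearMap.ext fun v => ?_
    simp only [LinearMap.sub_apply, Module.End.mul_apply]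

theorem diffAd_iterate_diffMul (m i : ℕ) (a : X) :
    (diffAd k N)^[m] (diffMul k N i a) = diffMul k N (i + m) a := by
  induction m with
  | zero => rfl
  | succ m ih =>
    rw [Function.iterate_succ_apply', ih, diffAd, diffD_diffMul, ← add_assoc]
    refine LinearMap.ext fun v => ?_
    simp only [LinearMap.sub_apply, LinearMap.add_apply, add_sub_cancel_right]

/-- The sequence `E d^n`. -/
noncomputable def diffSeq (E : Module.End k (DiffSpace k X)) : ℕ → Module.End k (DiffSpace k X) :=
  fun n => E * diffD k N ^ n

theorem shift_diffSeq (E : Module.End k (DiffSpace k X)) :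
    shift k (diffSeq k N E) = diffSeq k N (E * diffD k N) := by
  ext1 n
  rw [shift_apply, diffSeq, diffSeq, pow_succ', mul_assoc]

/-- Shifting `E d^n` multiplies `E` by `d` on the right, so one step of the recursion turns `E * G`
into `E d G - E G d = E [d, G]`. -/
theorem mul_diffSeq (m : ℕ) : ∀ E G : Module.End k (DiffSpace k X),
    mul k m (diffSeq k N E) (diffSeq k N G) = diffSeq k N (E * (diffAd k N)^[m] G) := by
  induction m with
  | zero => intro E G; ext1 n; simp [seq_mul_zero, diffSeq, mul_assoc]
  | succ m ih =>
    intro E G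
    rw [seq_mul_succ, shift_diffSeq, shift_diffSeq, ih, ih, diffAd_iterate_mul,
      Function.iterate_succ_apply', diffAd]
    ext1 n
    refine LinearMap.ext fun v => ?_
    simp only [diffSeq, Pi.sub_apply, LinearMap.sub_apply, Module.End.mul_apply, map_sub]

/-- The operator representing a normal word without `∂`. -/
noncomputable def diffVal (l : List (ℕ × X)) (c : X) : Module.End k (DiffSpace k X) :=
  l.foldr (fun p E => diffMul k N 0 p.2 * (diffAd k N)^[p.1] E) (diffMul k N 0 c)

/-- The generator `a` goes to the sequence `a d^n`. Then `a (n) b` goes to the sequence of the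
operator `a b^(n)`, which is zero exactly in the range demanded by the locality function or beyond;
this is all the universal property needs. -/
theorem exists_model : ∃ φ : Conf k N →ₗ[k] (ℕ → Module.End k (DiffSpace k X)),
    ∀ b : NormalWord N, φ (b.value k) = (D k)^[b.s] (diffSeq k N (diffVal k N b.l b.c)) := by
  obtain ⟨φ, h1, h2, h3⟩ := exists_lift (k := k) N (C := ℕ → Module.End k (DiffSpace k X))
    seq_D_mul seq_mul_D seq_assoc (fun a => diffSeq k N (diffMul k N 0 a)) (by
      intro a b n hn
      rw [mul_diffSeq, diffAd_iterate_diffMul, diffMul_diffMul k N _ _ _ _ (by omega)]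
      ext1; simp [diffSeq])
  refine ⟨φ, fun b => ?_⟩
  have e : ∀ (l : List (ℕ × X)) (c : X),
      φ (l.foldr (fun p z => mul k p.1 (gen k N p.2) z) (gen k N c)) =
        diffSeq k N (diffVal k N l c) := by
    intro l c
    induction l with
    | nil => exact h1 c
    | cons p l ih => rw [List.foldr_cons, h3, ih, h1, mul_diffSeq]; rfl
  have eD : ∀ (s : ℕ) (z : Conf k N), φ ((D k : Conf k N →ₗ[k] Conf k N)^[s] z) =
      (D k)^[s] (φ z) := by
    intro s z
    induction s with
    | zero => rfl
    | succ s ih => rw [Function.iterate_succ_apply', h2, ih, Function.iterate_succ_apply']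
  rw [NormalWord.value, eD, e]

theorem seq_D_iterate_apply {V : Type w} [AddCommGroup V] [Module k V] (s : ℕ)
    (φ : ℕ → Module.End k V) : ∀ n,
    ((D k)^[s] φ) n = (-1 : ℤ) ^ s • n.descFactorial s • φ (n - s) := by
  induction s with
  | zero => intro n; simp
  | succ s ih =>
    intro n
    rw [Function.iterate_succ_apply', seq_D_apply, ih]
    rcases n with _ | n
    · simp
    · rw [Nat.add_sub_cancel, Nat.succ_descFactorial_succ, pow_succ, Nat.add_sub_add_right,
        mul_smul, smul_comm (n + 1), mul_smul, neg_one_smul, smul_neg]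

/-- The value at `1` of the operator representing a normal word without `∂`. -/
noncomputable def diffVec (l : List (ℕ × X)) (c : X) : DiffSpace k X :=
  diffVal k N l c (Finsupp.single [] 1)

theorem diffD_one : diffD k N (Finsupp.single [] 1) = 0 := by
  rw [diffD_single, diffWord]

/-- Since `d` kills the empty word, commutators with `d` evaluated there become plain derivatives.
-/
theorem diffAd_iterate_one (m : ℕ) (E : Module.End k (DiffSpace k X)) :
    (diffAd k N)^[m] E (Finsupp.single [] 1) = (diffD k N ^ m) (E (Finsupp.single [] 1)) := by
  induction m with
  | zero => rfl
  | succ m ih =>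
    rw [Function.iterate_succ_apply', diffAd, LinearMap.sub_apply, Module.End.mul_apply,
      Module.End.mul_apply, diffD_one, map_zero, sub_zero, ih, pow_succ', Module.End.mul_apply]

theorem diffVec_cons (n : ℕ) (a : X) (l : List (ℕ × X)) (c : X) :
    diffVec k N ((n, a) :: l) c = diffMul k N 0 a ((diffD k N ^ n) (diffVec k N l c)) := by
  rw [diffVec, diffVal, List.foldr_cons, Module.End.mul_apply, diffAd_iterate_one]
  rfl

/-- Evaluation at the empty word separates the powers of `∂`: the `n`-th term involves `d^(n-s)`,
which kills that word for `n > s`, and the falling factorial vanishes for `n < s`. -/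
theorem seq_D_iterate_diffSeq_one (s n : ℕ) (l : List (ℕ × X)) (c : X) :
    ((D k)^[s] (diffSeq k N (diffVal k N l c))) n (Finsupp.single [] 1) =
      if n = s then (-1 : ℤ) ^ s • s.factorial • diffVec k N l c else 0 := by
  rw [seq_D_iterate_apply, LinearMap.smul_apply, LinearMap.smul_apply, diffSeq,
    Module.End.mul_apply]
  split_ifs with h
  · subst h
    simp [Nat.descFactorial_self, diffVec]
  · rcases lt_or_gt_of_ne h with h | h
    · simp [Nat.descFactorial_of_lt h]
    · obtain ⟨j, hj⟩ : ∃ j, n - s = j + 1 := ⟨n - s - 1, by omega⟩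
      rw [hj, pow_succ, Module.End.mul_apply, diffD_one, map_zero, map_zero, smul_zero, smul_zero]

/-- The span of words whose sequence of exponents is lexicographically smaller than `μ`. -/
noncomputable def lexLow (k : Type v) [Field k] (X : Type u) (μ : List ℕ) :
    Submodule k (DiffSpace k X) :=
  Submodule.span k {v | ∃ w : List (ℕ × X), w.map Prod.fst < μ ∧ v = Finsupp.single w 1}

theorem diffCons_mem (i : ℕ) (a : X) (w : List (ℕ × X)) {μ : List ℕ}
    (h : i :: w.map Prod.fst < μ) : diffCons k N i a w ∈ lexLow k X μ := by
  have hm : Finsupp.single ((i, a) :: w) (1 : k) ∈ lexLow k X μ :=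
    Submodule.subset_span ⟨_, by simpa using h, rfl⟩
  rcases w with _ | ⟨⟨n, b⟩, w⟩
  · exact hm
  · rw [diffCons]
    split_ifs
    exacts [hm, zero_mem _]

theorem diffMul_mem_of_lt (i j : ℕ) (hij : i < j) (μ : List ℕ) (a : X) (v : DiffSpace k X) :
    diffMul k N i a v ∈ lexLow k X (j :: μ) := by
  induction v using Finsupp.induction_linear with
  | zero => simp
  | add x y hx hy => rw [map_add]; exact add_mem hx hy
  | single w r =>
    rw [← mul_one r, ← smul_eq_mul, ← Finsupp.smul_single, map_smul, diffMul_single]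
    exact Submodule.smul_mem _ _ (diffCons_mem k N i a w (.rel hij))

theorem diffMul_mem_of_mem (i : ℕ) (μ : List ℕ) (a : X) {v : DiffSpace k X}
    (hv : v ∈ lexLow k X μ) : diffMul k N i a v ∈ lexLow k X (i :: μ) := by
  induction hv using Submodule.span_induction with
  | mem x hx =>
    obtain ⟨w, hw, rfl⟩ := hx
    rw [diffMul_single]
    exact diffCons_mem k N i a w (.cons hw)
  | zero => simp
  | add x y _ _ hx hy => rw [map_add]; exact add_mem hx hy
  | smul r x _ hx => rw [map_smul]; exact Submodule.smul_mem _ _ hx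

/-- The derivatives of `a v` are congruent to `a^(j) v`. -/
theorem diffD_pow_diffMul (j : ℕ) (a : X) (v : DiffSpace k X) :
    ∀ μ, (diffD k N ^ j) (diffMul k N 0 a v) - diffMul k N j a v ∈ lexLow k X (j :: μ) := by
  -- By the Leibniz rule every error term has some derivative fall on `v`, which leaves `a` with an
  -- exponent `i < j`; the first exponent alone then decides the lexicographic comparison, whatever
  -- `μ` is.
  suffices h : ∀ j, ((diffD k N ^ j) (diffMul k N 0 a v) - diffMul k N j a v) ∈
      Submodule.span k {y | ∃ i v', i < j ∧ y = diffMul k N i a v'} by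
    intro μ
    refine Submodule.span_le.2 ?_ (h j)
    rintro _ ⟨i, v', hi, rfl⟩
    exact diffMul_mem_of_lt k N i j hi μ a v'
  intro j
  induction j with
  | zero => simp
  | succ j ih =>
    have comm : ∀ i v', diffD k N (diffMul k N i a v') =
        diffMul k N (i + 1) a v' + diffMul k N i a (diffD k N v') := fun i v' =>
      LinearMap.congr_fun (diffD_diffMul k N i a) v'
    have e : (diffD k N ^ (j + 1)) (diffMul k N 0 a v) - diffMul k N (j + 1) a v =
        diffD k N ((diffD k N ^ j) (diffMul k N 0 a v) - diffMul k N j a v) +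
          diffMul k N j a (diffD k N v) := by
      rw [map_sub, comm, pow_succ', Module.End.mul_apply]; abel
    rw [e]
    refine add_mem ?_ (Submodule.subset_span ⟨j, _, by omega, rfl⟩)
    clear e
    generalize (diffD k N ^ j) (diffMul k N 0 a v) - diffMul k N j a v = y at ih
    induction ih using Submodule.span_induction with
    | mem x hx =>
      obtain ⟨i, v', hi, rfl⟩ := hx
      rw [comm]
      exact add_mem (Submodule.subset_span ⟨_, _, by omega, rfl⟩)
        (Submodule.subset_span ⟨_, _, by omega, rfl⟩)
    | zero => simp
    | add x y _ _ hx hy => rw [map_add]; exact add_mem hx hy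
    | smul r x _ hx => rw [map_smul]; exact Submodule.smul_mem _ _ hx

/-- The principal word of the `j`-th derivative of `diffVec l c`. -/
def diffLead (c : X) : ℕ → List (ℕ × X) → List (ℕ × X)
  | j, [] => [(j, c)]
  | j, (n, a) :: l => (j, a) :: diffLead c n l

/-- The orders `n_i` appear shifted by one place, as exponents of the letters `a_{i+1}`, so the word
determines everything. -/
theorem diffLead_injective {c c' : X} : ∀ {l l' : List (ℕ × X)} {j j' : ℕ},
    diffLead c j l = diffLead c' j' l' → j = j' ∧ l = l' ∧ c = c'
  | [], [], j, j', h => by simpa [diffLead] using h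
  | [], (n, a) :: l', j, j', h => by
    rcases l' with _ | ⟨⟨_, _⟩, _⟩ <;> simp [diffLead] at h
  | (n, a) :: l, [], j, j', h => by
    rcases l with _ | ⟨⟨_, _⟩, _⟩ <;> simp [diffLead] at h
  | (n, a) :: l, (n', a') :: l', j, j', h => by
    simp only [diffLead, List.cons.injEq, Prod.mk.injEq] at h
    obtain ⟨rfl, rfl, rfl⟩ := diffLead_injective h.2
    exact ⟨h.1.1, by rw [h.1.2], rfl⟩

theorem diffVec_sub_mem (c : X) (l : List (ℕ × X)) : IsNormalList N c l → ∀ j,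
    (diffD k N ^ j) (diffVec k N l c) - Finsupp.single (diffLead c j l) 1 ∈
      lexLow k X ((diffLead c j l).map Prod.fst) := by
  induction l with
  | nil =>
    intro _ j
    have h := diffD_pow_diffMul k N j c (Finsupp.single [] 1) []
    rw [diffMul_single k N j] at h
    exact h
  | cons p l ih =>
    obtain ⟨n, a⟩ := p
    rintro ⟨hn, hl⟩ j
    rw [diffVec_cons]
    have h1 := diffD_pow_diffMul k N j a ((diffD k N ^ n) (diffVec k N l c))
      ((diffLead c n l).map Prod.fst)
    have h2 := diffMul_mem_of_mem k N j _ a (ih hl n)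
    rw [map_sub, diffMul_single] at h2
    -- Normality `n < N a b`, with `b` the next letter, is precisely the condition for the product
    -- with the principal word not to vanish.
    have h3 : diffCons k N j a (diffLead c n l) =
        Finsupp.single (diffLead c j ((n, a) :: l)) 1 := by
      rcases l with _ | ⟨⟨m, b⟩, l⟩
      · rw [diffLead, diffLead, diffLead, diffCons, if_pos (by simpa using hn)]
      · rw [diffLead, diffLead, diffLead, diffCons, if_pos (by simpa using hn)]
    rw [h3] at h2
    simpa [diffLead] using add_mem h1 h2

theorem lexLow_apply {μ : List ℕ} {v : DiffSpace k X} (hv : v ∈ lexLow k X μ)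
    {w : List (ℕ × X)} (hw : ¬ w.map Prod.fst < μ) : v w = 0 := by
  classical
  induction hv using Submodule.span_induction with
  | mem x hx =>
    obtain ⟨w', hw', rfl⟩ := hx
    rw [Finsupp.single_apply, if_neg (by rintro rfl; exact hw hw')]
  | zero => rfl
  | add x y _ _ hx hy => rw [Finsupp.add_apply, hx, hy, add_zero]
  | smul r x _ hx => rw [Finsupp.smul_apply, hx, smul_zero]

/-- The normal words are linearly independent in `Conf k N`. -/
theorem linearIndependent_value [CharZero k] :
    LinearIndependent k (fun b : NormalWord N => b.value k) := by
  classical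
  obtain ⟨φ, hφ⟩ := exists_model k N
  rw [linearIndependent_iff]
  intro f hf
  by_contra hne
  -- By maximality, no tail of another `diffVec` in the support can contain the principal word of
  -- `b`.
  obtain ⟨b, hb, hmax⟩ := Finset.exists_max_image f.support
    (fun b => (diffLead b.c 0 b.l).map Prod.fst) (Finsupp.support_nonempty_iff.2 hne)
  -- The functional `θ` takes the term of index `b.s`, applies it to the empty word and reads off
  -- the coefficient of the principal word of `b`. On the support of `f` it is nonzero only at `b`,
  -- with value `± b.s!`.
  let θ : Conf k N →ₗ[k] k := Finsupp.lapply (diffLead b.c 0 b.l) ∘ₗ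
    LinearMap.applyₗ (Finsupp.single [] 1) ∘ₗ LinearMap.proj b.s ∘ₗ φ
  have hθ : ∀ b', θ (NormalWord.value k b') = if b.s = b'.s then
      (-1 : ℤ) ^ b'.s • b'.s.factorial • diffVec k N b'.l b'.c (diffLead b.c 0 b.l) else 0 := by
    intro b'
    have e : θ (NormalWord.value k b') = ((D k)^[b'.s] (diffSeq k N (diffVal k N b'.l b'.c))) b.s
      (Finsupp.single [] 1) (diffLead b.c 0 b.l) := by
      simp [θ, hφ]
    rw [e, seq_D_iterate_diffSeq_one]
    split_ifs <;> simp
  have hc : ∀ b' ∈ f.support, diffVec k N b'.l b'.c (diffLead b.c 0 b.l) =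
      if diffLead b'.c 0 b'.l = diffLead b.c 0 b.l then 1 else 0 := by
    intro b' hb'
    have h := lexLow_apply k (diffVec_sub_mem k N b'.c b'.l b'.normal 0) (not_lt.2 (hmax b' hb'))
    rw [pow_zero, Module.End.one_apply, Finsupp.sub_apply, sub_eq_zero] at h
    rw [h, Finsupp.single_apply]
  have h0 : ∑ b' ∈ f.support, f b' * θ (b'.value k) = 0 := by
    have := congrArg θ hf
    rw [Finsupp.linearCombination_apply, Finsupp.sum, map_sum, map_zero] at this
    simpa using this
  rw [Finset.sum_eq_single_of_mem b hb] at h0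
  · rw [hθ, if_pos rfl, hc b hb, if_pos rfl] at h0
    have : (b.s.factorial : k) ≠ 0 := by exact_mod_cast b.s.factorial_ne_zero
    simp [Finsupp.mem_support_iff.1 hb, this] at h0
  · intro b' hb' hne'
    rw [hθ, hc b' hb']
    split_ifs with h1 h2
    · obtain ⟨-, h3, h4⟩ := diffLead_injective h2
      refine absurd ?_ hne'
      cases b; cases b'; simp_all
    · simp
    · simp

end Model

/-! ### The action of `k⟨Z⟩` on an associative conformal algebra -/

section Action

variable {k : Type v} [Field k] {X : Type u} {C : Type w} [AddCommGroup C] [Module k C]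
  [ConformalOps k C] [IsAssocConformal k C] (g : X → C)

/-- The operators on `C` corresponding to the letters from `O`. -/
noncomputable def opEnd (k : Type v) [Field k] {X : Type u} {C : Type w} [AddCommGroup C]
    [Module k C] [ConformalOps k C] [IsAssocConformal k C] (g : X → C) : Op X → C →ₗ[k] C
  | .d => D k
  | .L n a => mul k n (g a)
  | .R n b => rOp k n (g b)

/-- The operators on `k × C` corresponding to the letters: those from `O` act on `C`, and `x ∈ X`
maps `(1, 0)` to the generator `x`. -/
noncomputable def letterEnd (k : Type v) [Field k] {X : Type u} {C : Type w} [AddCommGroup C]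
    [Module k C] [ConformalOps k C] [IsAssocConformal k C] (g : X → C) :
    Letter X → Module.End k (k × C)
  | .inl o => LinearMap.inr k k C ∘ₗ opEnd k g o ∘ₗ LinearMap.snd k k C
  | .inr x => LinearMap.inr k k C ∘ₗ LinearMap.toSpanSingleton k C (g x) ∘ₗ LinearMap.fst k k C

theorem letterEnd_inl (o : Op X) (p : k × C) :
    letterEnd k g (.inl o) p = (0, opEnd k g o p.2) := rfl

theorem letterEnd_inr (x : X) (p : k × C) : letterEnd k g (.inr x) p = (0, p.1 • g x) := rfl

/-- The action of `k⟨Z⟩` on `k × C`. -/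
noncomputable def action (k : Type v) [Field k] {X : Type u} {C : Type w} [AddCommGroup C]
    [Module k C] [ConformalOps k C] [IsAssocConformal k C] (g : X → C) :
    FreeAlg k X →ₐ[k] Module.End k (k × C) :=
  MonoidAlgebra.lift k (Module.End k (k × C)) (FreeMonoid (Letter X))
    (FreeMonoid.lift (letterEnd k g))

theorem action_nil : action k g (mono k []) = 1 := by rw [mono_nil, map_one]

theorem action_cons (z : Letter X) (w : Word X) :
    action k g (mono k (z :: w)) = letterEnd k g z * action k g (mono k w) := by
  have : mono k (z :: w) = mono k [z] * mono k w := (mono_mul_mono [z] w).symm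
  rw [this, map_mul]
  congr 1
  simp [action, mono]

/-- The element of `C` represented by an element of `k⟨Z⟩`. -/
noncomputable def represent (k : Type v) [Field k] {X : Type u} {C : Type w} [AddCommGroup C]
    [Module k C] [ConformalOps k C] [IsAssocConformal k C] (g : X → C) : FreeAlg k X →ₗ[k] C :=
  LinearMap.snd k k C ∘ₗ LinearMap.applyₗ (1, 0) ∘ₗ (action k g).toLinearMap

theorem represent_apply (f : FreeAlg k X) : represent k g f = (action k g f (1, 0)).2 := rfl

theorem represent_op_mul (o : Op X) (f : FreeAlg k X) :
    represent k g (mono k [.inl o] * f) = opEnd k g o (represent k g f) := by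
  rw [represent_apply, map_mul, action_cons, action_nil, mul_one, Module.End.mul_apply,
    letterEnd_inl]
  rfl

/-- The element of `C` represented by the word `∂^s L_{n₁}^{a₁} ⋯ L_{n_k}^{a_k} c`. -/
noncomputable def wordValue (k : Type v) [Field k] {X : Type u} {C : Type w} [AddCommGroup C]
    [Module k C] [ConformalOps k C] (g : X → C) (s : ℕ) (l : List (ℕ × X)) (c : X) : C :=
  (D k : C →ₗ[k] C)^[s] (l.foldr (fun p z => mul k p.1 (g p.2) z) (g c))

theorem lWord_succ (s : ℕ) (l : List (ℕ × X)) (c : X) :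
    lWord (s + 1) l c = .inl .d :: lWord s l c := rfl

theorem lWord_cons (n : ℕ) (a : X) (l : List (ℕ × X)) (c : X) :
    lWord 0 ((n, a) :: l) c = .inl (.L n a) :: lWord 0 l c := rfl

theorem lWord_nil (c : X) : lWord 0 [] c = [.inr c] := rfl

theorem action_lWord (s : ℕ) (l : List (ℕ × X)) (c : X) (p : k × C) :
    action k g (mono k (lWord s l c)) p = (0, p.1 • wordValue k g s l c) := by
  induction s with
  | zero =>
    induction l with
    | nil =>
      rw [lWord_nil, action_cons, action_nil, mul_one, letterEnd_inr]
      rfl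
    | cons q l ih =>
      rw [lWord_cons, action_cons, Module.End.mul_apply, ih, letterEnd_inl]
      simp [opEnd, wordValue]
  | succ s ih =>
    rw [lWord_succ, action_cons, Module.End.mul_apply, ih, letterEnd_inl]
    simp only [opEnd, wordValue, Function.iterate_succ_apply', map_smul]

theorem represent_lWord (s : ℕ) (l : List (ℕ × X)) (c : X) :
    represent k g (mono k (lWord s l c)) = wordValue k g s l c := by
  rw [represent_apply, action_lWord, one_smul]

variable {N : X → X → ℕ}

theorem action_algRel [CharZero k] {p : FreeAlg k X} (hp : AlgRel p) : action k g p = 0 := by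
  refine LinearMap.ext fun q => ?_
  cases hp with
  | L_d n a =>
    simp [action_cons, action_nil, letterEnd_inl, opEnd, IsAssocConformal.mul_D]
  | R_d n a =>
    simp [action_cons, action_nil, letterEnd_inl, opEnd, rOp_D]
  | R_L n m a b =>
    simp [action_cons, action_nil, letterEnd_inl, opEnd, rOp_mul]

/-- Every letter maps into `0 × C`, while a letter from `X` only reads the first coordinate. -/
theorem action_nullExt {p : FreeAlg k X} (hp : p ∈ nullExt k X) : action k g p = 0 := by
  obtain ⟨x, z, rfl⟩ := hp
  refine LinearMap.ext fun q => ?_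
  rcases z with o | y <;>
    simp [action_cons, action_nil, letterEnd_inl, letterEnd_inr]

theorem action_freeRel (hg : ∀ (a b : X) (n : ℕ), N a b ≤ n → mul k n (g a) (g b) = 0)
    {p : FreeAlg k X} (hp : FreeRel k N p) : action k g p = 0 := by
  refine LinearMap.ext fun q => ?_
  cases hp with
  | locality a b n hn =>
    simp [action_cons, action_nil, letterEnd_inl, letterEnd_inr, opEnd, hg a b n hn]
  | right a b n =>
    rw [map_sub, LinearMap.sub_apply, LinearMap.zero_apply, sub_eq_zero, map_sum,
      LinearMap.sum_apply]
    simp only [map_smul, LinearMap.smul_apply, action_lWord]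
    rw [action_cons, action_cons, action_nil, mul_one, Module.End.mul_apply, letterEnd_inr,
      letterEnd_inl]
    have h := rOp_eq_sum k (hg a b) (n := n) (B := N a b - n) (by omega)
    simp only [opEnd, map_smul, h, Finset.smul_sum]
    ext
    · simp [Prod.fst_sum]
    · simp only [Prod.snd_sum, Prod.smul_snd]
      refine Finset.sum_congr rfl fun s _ => ?_
      simp only [wordValue, dDiv, List.foldr_cons, List.foldr_nil, LinearMap.smul_apply,
        Module.End.pow_apply]
      rw [← Int.cast_smul_eq_zsmul k]
      simp only [smul_smul]
      congr 1
      push_cast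
      ring
  | extended a b n m hn l c hl =>
    rw [map_add, LinearMap.add_apply, LinearMap.zero_apply, map_sum, LinearMap.sum_apply]
    simp only [map_smul, LinearMap.smul_apply, action_lWord]
    -- The relation is the expansion of `(a (n) b) (m) u` with `a (n) b = 0`; its summand for index
    -- zero is the principal word.
    have h := mul_mul_eq k n m (g a) (g b) (wordValue k g 0 l c)
    rw [hg a b n hn, map_zero, LinearMap.zero_apply, Finset.range_eq_Ico,
      Finset.sum_eq_sum_Ico_succ_bot (by omega)] at h
    ext
    · simp [Prod.fst_sum]
    · simp only [Prod.snd_add, Prod.snd_sum, Prod.smul_snd, Prod.snd_zero]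
      have e : ∀ i j, wordValue k g 0 ((i, a) :: (j, b) :: l) c =
          mul k i (g a) (mul k j (g b) (wordValue k g 0 l c)) := fun _ _ => rfl
      simp only [e]
      rw [← smul_zero (M := k) (A := C) q.1, h, smul_add, Finset.smul_sum]
      congr 1
      · simp
      · refine Finset.sum_congr (by ext; simp) fun i _ => ?_
        rw [← Int.cast_smul_eq_zsmul k, ← Nat.cast_smul_eq_nsmul k]
        simp only [smul_smul]
        congr 1
        push_cast
        ring

end Action

/-! ### Principal words of the relations -/

section Relations

variable {k : Type v} [Field k] {X : Type u}

/-- The defining relations of the module `Conf k N`. -/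
def relSet (k : Type v) [Field k] {X : Type u} (N : X → X → ℕ) : Set (FreeAlg k X) :=
  {p | FreeRel k N p} ∪ {p | AlgRel p} ∪ nullExt k X

/-- The principal words of the defining relations. -/
inductive RelLead (N : X → X → ℕ) : Word X → Prop
  | L_d (n : ℕ) (a : X) : RelLead N [.inl (.L n a), .inl .d]
  | R_d (n : ℕ) (a : X) : RelLead N [.inl (.R n a), .inl .d]
  | R_L (n m : ℕ) (a b : X) : RelLead N [.inl (.R m b), .inl (.L n a)]
  | null (x : X) (z : Letter X) : RelLead N [.inr x, z]
  | locality (a b : X) (n : ℕ) (hn : N a b ≤ n) : RelLead N [.inl (.L n a), .inr b]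
  | right (a b : X) (n : ℕ) : RelLead N [.inl (.R n b), .inr a]
  | extended (a b : X) (n m : ℕ) (hn : N a b ≤ n) (l : List (ℕ × X)) (c : X)
      (hl : IsNormalList N c l) : RelLead N (lWord 0 ((n, a) :: (m, b) :: l) c)

theorem genDegree_lWord (s : ℕ) (l : List (ℕ × X)) (c : X) : genDegree (lWord s l c) = 1 := by
  simp only [lWord, genDegree_append]
  simp [genDegree, List.countP_replicate, List.countP_map, Function.comp_def]

theorem rDegree_lWord (s : ℕ) (l : List (ℕ × X)) (c : X) : rDegree (lWord s l c) = 0 := by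
  simp only [lWord, rDegree_append]
  simp [rDegree, List.countP_replicate, List.countP_map, Function.comp_def]

variable [LinearOrder X]

/-- The span of the words smaller than `l` with the same number of letters from `X`. -/
noncomputable abbrev lowSpan (k : Type v) [Field k] (l : Word X) : Submodule k (FreeAlg k X) :=
  wordSpan k fun w => wordLT w l ∧ genDegree w = genDegree l

theorem isLeading_of_sub_mem_lowSpan {f : FreeAlg k X} {l : Word X}
    (h : f - mono k l ∈ lowSpan k l) : IsLeading f l :=
  (isLeading_of_sub_mem (wordSpan_mono (fun _ hw => hw.1) h)).1

theorem isMonic_of_sub_mem_lowSpan {f : FreeAlg k X} {l : Word X}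
    (h : f - mono k l ∈ lowSpan k l) : IsMonic f :=
  ⟨l, isLeading_of_sub_mem (wordSpan_mono (fun _ hw => hw.1) h)⟩

theorem L_d_mem (n : ℕ) (a : X) : mono k [.inl (.L n a), .inl .d] -
    mono k [.inl .d, .inl (.L n a)] - n • mono k [.inl (.L (n - 1) a)] -
    mono k [.inl (.L n a), .inl .d] ∈ lowSpan k [.inl (.L n a), .inl .d] := by
  have e : mono k [.inl (.L n a), .inl .d] - mono k [.inl .d, .inl (.L n a)] -
      n • mono k [.inl (.L (n - 1) a)] - mono k [.inl (.L n a), .inl .d] =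
      -(mono k [.inl .d, .inl (.L n a)] + n • mono k [.inl (.L (n - 1) a)]) := by abel
  rw [e]
  refine neg_mem (add_mem (mono_mem_wordSpan ?_) (nsmul_mem (mono_mem_wordSpan ?_) n)) <;>
    simp [wordLT, genDegree, rDegree, letterLT, Op.lt, List.cons_lex_cons_iff]

theorem R_d_mem (n : ℕ) (a : X) : mono k [.inl (.R n a), .inl .d] -
    mono k [.inl .d, .inl (.R n a)] - n • mono k [.inl (.R (n - 1) a)] -
    mono k [.inl (.R n a), .inl .d] ∈ lowSpan k [.inl (.R n a), .inl .d] := by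
  have e : mono k [.inl (.R n a), .inl .d] - mono k [.inl .d, .inl (.R n a)] -
      n • mono k [.inl (.R (n - 1) a)] - mono k [.inl (.R n a), .inl .d] =
      -(mono k [.inl .d, .inl (.R n a)] + n • mono k [.inl (.R (n - 1) a)]) := by abel
  rw [e]
  refine neg_mem (add_mem (mono_mem_wordSpan ?_) (nsmul_mem (mono_mem_wordSpan ?_) n)) <;>
    simp [wordLT, genDegree, rDegree, letterLT, Op.lt, List.cons_lex_cons_iff]

theorem R_L_mem (n m : ℕ) (a b : X) : mono k [.inl (.R m b), .inl (.L n a)] -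
    mono k [.inl (.L n a), .inl (.R m b)] - mono k [.inl (.R m b), .inl (.L n a)] ∈
      lowSpan k [.inl (.R m b), .inl (.L n a)] := by
  rw [sub_sub_cancel_left]
  refine neg_mem (mono_mem_wordSpan ?_)
  simp [wordLT, genDegree, rDegree, letterLT, Op.lt, List.cons_lex_cons_iff]

variable {N : X → X → ℕ}

theorem right_mem (a b : X) (n : ℕ) (f : ℕ → k) :
    mono k [.inl (.R n b), .inr a] - ∑ s ∈ Finset.range (N a b - n),
        f s • mono k (lWord s [(n + s, a)] b) - mono k [.inl (.R n b), .inr a] ∈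
      lowSpan k [.inl (.R n b), .inr a] := by
  rw [sub_sub_cancel_left]
  refine neg_mem (sum_mem fun s _ => Submodule.smul_mem _ _ (mono_mem_wordSpan ?_))
  rw [wordLT, genDegree_lWord, rDegree_lWord]
  simp [genDegree, rDegree]

theorem extended_mem (a b : X) (n m : ℕ) (l : List (ℕ × X)) (c : X) (f : ℕ → k) :
    mono k (lWord 0 ((n, a) :: (m, b) :: l) c) + ∑ q ∈ Finset.Icc 1 n, f q •
          mono k (lWord 0 ((n - q, a) :: (m + q, b) :: l) c) -
        mono k (lWord 0 ((n, a) :: (m, b) :: l) c) ∈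
      lowSpan k (lWord 0 ((n, a) :: (m, b) :: l) c) := by
  rw [add_sub_cancel_left]
  refine sum_mem fun q hq => Submodule.smul_mem _ _ (mono_mem_wordSpan ?_)
  rw [Finset.mem_Icc] at hq
  rw [wordLT]
  simp only [genDegree_lWord, rDegree_lWord]
  simp only [lWord_cons, List.length_cons, List.cons_lex_cons_iff]
  simp only [letterLT, Sum.lex_inl_inl, Op.lt]
  simp only [true_and, and_true, lt_irrefl, false_or]
  exact .inl (.inl (by omega))

theorem exists_relLead {t : FreeAlg k X} (ht : t ∈ relSet k N) :
    ∃ l, RelLead N l ∧ t - mono k l ∈ lowSpan k l := by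
  rcases ht with (ht | ht) | ⟨x, z, rfl⟩
  · cases ht with
    | locality a b n hn => exact ⟨_, .locality a b n hn, by simp⟩
    | right a b n => exact ⟨_, .right a b n, right_mem a b n _⟩
    | extended a b n m hn l c hl => exact ⟨_, .extended a b n m hn l c hl,
        extended_mem a b n m l c _⟩
  · cases ht with
    | L_d n a => exact ⟨_, .L_d n a, L_d_mem n a⟩
    | R_d n a => exact ⟨_, .R_d n a, R_d_mem n a⟩
    | R_L n m a b => exact ⟨_, .R_L n m a b, R_L_mem n m a b⟩
  · exact ⟨_, .null x z, by simp⟩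

theorem RelLead.exists_mem {l : Word X} (hl : RelLead N l) :
    ∃ t ∈ relSet k N, t - mono k l ∈ lowSpan k l := by
  cases hl with
  | L_d n a => exact ⟨_, .inl (.inr (.L_d n a)), L_d_mem n a⟩
  | R_d n a => exact ⟨_, .inl (.inr (.R_d n a)), R_d_mem n a⟩
  | R_L n m a b => exact ⟨_, .inl (.inr (.R_L n m a b)), R_L_mem n m a b⟩
  | null x z => exact ⟨_, .inr ⟨x, z, rfl⟩, by simp⟩
  | locality a b n hn => exact ⟨_, .inl (.inl (.locality a b n hn)), by simp⟩
  | right a b n => exact ⟨_, .inl (.inl (.right a b n)), right_mem a b n _⟩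
  | extended a b n m hn l c hl =>
    exact ⟨_, .inl (.inl (.extended a b n m hn l c hl)), extended_mem a b n m l c _⟩

end Relations

/-! ### Reduction to normal words -/

section Reduction

variable {X : Type u} (N : X → X → ℕ)

/-- A letter put before a normal word can create an obstruction only at the very front, so words can
be examined from right to left. -/
theorem op_cons_normal (o : Op X) (b : NormalWord N) :
    (∃ l v, RelLead N l ∧ Sum.inl o :: b.word = l ++ v) ∨
      ∃ b' : NormalWord N, Sum.inl o :: b.word = b'.word := by
  obtain ⟨s, l, c, h⟩ := b
  rcases o with _ | ⟨n, a⟩ | ⟨n, a⟩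
  · exact .inr ⟨⟨s + 1, l, c, h⟩, rfl⟩
  · rcases s with _ | s
    · rcases l with _ | ⟨⟨m, b⟩, l⟩
      · by_cases hn : n < N a c
        · exact .inr ⟨⟨0, [(n, a)], c, hn, trivial⟩, rfl⟩
        · exact .inl ⟨_, [], .locality a c n (by omega), rfl⟩
      · by_cases hn : n < N a b
        · exact .inr ⟨⟨0, (n, a) :: (m, b) :: l, c, hn, h⟩, rfl⟩
        · exact .inl ⟨_, [], .extended a b n m (by omega) l c h.2, by simp; rfl⟩
    · exact .inl ⟨_, lWord s l c, .L_d n a, rfl⟩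
  · rcases s with _ | s
    · rcases l with _ | ⟨⟨m, b⟩, l⟩
      · exact .inl ⟨_, [], .right c a n, rfl⟩
      · exact .inl ⟨_, lWord 0 l c, .R_L m n b a, rfl⟩
    · exact .inl ⟨_, lWord s l c, .R_d n a, rfl⟩

/-- A word with a letter from `X` contains a principal word of a relation or is normal. -/
theorem relLead_or_normal (w : Word X) (hw : 1 ≤ genDegree w) :
    (∃ l u v, RelLead N l ∧ w = u ++ l ++ v) ∨ ∃ b : NormalWord N, w = b.word := by
  induction w with
  | nil => simp [genDegree] at hw
  | cons z w ih =>
    by_cases h : 1 ≤ genDegree w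
    · rcases ih h with ⟨l, u, v, hl, rfl⟩ | ⟨b, rfl⟩
      · exact .inl ⟨l, z :: u, v, hl, rfl⟩
      · rcases z with o | x
        · rcases op_cons_normal N o b with ⟨l, v, hl, e⟩ | h
          · exact .inl ⟨l, [], v, hl, e⟩
          · exact .inr h
        · rcases hb : b.word with _ | ⟨z, v⟩
          · rw [hb] at h; simp [genDegree] at h
          · exact .inl ⟨_, [], v, .null x z, rfl⟩
    · rcases z with o | x
      · refine absurd ?_ h
        simpa [genDegree] using hw
      · rcases w with _ | ⟨z, v⟩
        · exact .inr ⟨⟨0, [], x, trivial⟩, rfl⟩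
        · exact .inl ⟨_, [], v, .null x z, rfl⟩

/-- Nonempty final segments of normal words are normal. -/
theorem normal_suffix (u : Word X) : ∀ (b : NormalWord N) (w : Word X), w ≠ [] →
    b.word = u ++ w → ∃ b' : NormalWord N, w = b'.word := by
  induction u with
  | nil => exact fun b w _ h => ⟨b, h.symm⟩
  | cons z u ih =>
    rintro ⟨s, l, c, hb⟩ w hw h
    rcases s with _ | s
    · rcases l with _ | ⟨p, l⟩
      · rw [NormalWord.word, lWord_nil, List.cons_append, List.cons.injEq] at h
        have := h.2.symm
        simp [hw] at this
      · exact ih ⟨0, l, c, hb.2⟩ w hw (List.cons.inj h).2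
    · exact ih ⟨s, l, c, hb⟩ w hw (List.cons.inj h).2

theorem RelLead.not_normal_prefix {N : X → X → ℕ} {l : Word X} (hl : RelLead N l) (v : Word X)
    (b : NormalWord N) : l ++ v ≠ b.word := by
  obtain ⟨s, lb, c, hb⟩ := b
  intro h
  rcases s with _ | s
  · rcases lb with _ | ⟨⟨i, x⟩, _ | ⟨⟨j, y⟩, lb⟩⟩
    · cases hl <;> simp [NormalWord.word, lWord] at h
    · cases hl with
      | locality a b n hn =>
        simp [NormalWord.word, lWord] at h
        obtain ⟨⟨rfl, rfl⟩, rfl, -⟩ := h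
        exact absurd hb.1 (not_lt.2 hn)
      | _ => simp [NormalWord.word, lWord] at h
    · cases hl with
      | extended a b n m hn l c hl =>
        simp [NormalWord.word, lWord] at h
        obtain ⟨⟨rfl, rfl⟩, ⟨rfl, rfl⟩, -⟩ := h
        exact absurd hb.1 (not_lt.2 hn)
      | _ => simp [NormalWord.word, lWord] at h
  · cases hl <;> simp [NormalWord.word, lWord, List.replicate_succ] at h

theorem RelLead.not_normal {N : X → X → ℕ} {l : Word X} (hl : RelLead N l) (u v : Word X)
    (b : NormalWord N) : b.word ≠ u ++ l ++ v := by
  intro h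
  rw [List.append_assoc] at h
  obtain ⟨b', hb'⟩ := normal_suffix N u b (l ++ v) (by cases hl <;> simp [lWord]) h
  exact hl.not_normal_prefix v b' hb'

end Reduction

/-! ### Ideals of `Conf k N` as submodules over the operators `∂`, `L_n^a`, `R_n^a` -/

section OperatorSubmodules

variable {k : Type v} [Field k] {X : Type u} {N : X → X → ℕ} {J : Submodule k (Conf k N)}

theorem mul_mem_of_gen_mul_mem
    (hL : ∀ (n : ℕ) (x : X), ∀ v ∈ J, mul k n (gen k N x) v ∈ J) (a : Conf k N) :
    ∀ n, ∀ v ∈ J, mul k n a v ∈ J := by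
  refine conf_induction k N (P := fun a => ∀ n, ∀ v ∈ J, mul k n a v ∈ J)
    ?_ ?_ ?_ ?_ ?_ ?_ a
  · intro n v _; simp
  · intro a b ha hb n v hv
    rw [map_add, LinearMap.add_apply]
    exact add_mem (ha n v hv) (hb n v hv)
  · intro c a ha n v hv
    rw [map_smul, LinearMap.smul_apply]
    exact Submodule.smul_mem _ _ (ha n v hv)
  · exact fun x n v hv => hL n x v hv
  · intro a ha n v hv
    rw [conf_D_mul]
    exact neg_mem (nsmul_mem (ha _ v hv) n)
  · intro n a b ha hb m v hv
    rw [mul_mul_eq]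
    exact sum_mem fun q _ => nsmul_mem (zsmul_mem (ha _ _ (hb _ v hv)) _) _

/-- Descending induction on `n`, starting where locality gives zero: `R_n^x v` equals `± v (n) x`
plus derivatives of products of higher order, which already lie in `J`. -/
theorem mul_gen_mem_of_rOp_mem (hD : ∀ v ∈ J, D k v ∈ J)
    (hR : ∀ (n : ℕ) (x : X), ∀ v ∈ J, rOp k n (gen k N x) v ∈ J) (x : X) {v : Conf k N}
    (hv : v ∈ J) (n : ℕ) : mul k n v (gen k N x) ∈ J := by
  obtain ⟨M, hM⟩ := conf_locality k N v (gen k N x)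
  have hdiv : ∀ (s : ℕ) (y : Conf k N), y ∈ J → dDiv k s y ∈ J := by
    intro s y hy
    refine Submodule.smul_mem _ _ ?_
    induction s with
    | zero => exact hy
    | succ s ih => rw [pow_succ', Module.End.mul_apply]; exact hD _ ih
  suffices h : ∀ d n, M ≤ n + d → mul k n v (gen k N x) ∈ J from h M n (by omega)
  intro d
  induction d with
  | zero => intro n hn; rw [hM n (by omega)]; exact zero_mem _
  | succ d ih =>
    intro n hn
    have h := rOp_eq_sum k hM (n := n) (B := M + 1) (by omega)
    rw [Finset.sum_range_succ', add_zero, dDiv_zero] at h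
    have h1 : (-1 : ℤ) ^ n • mul k n v (gen k N x) ∈ J := by
      rw [← sub_eq_iff_eq_add'.2 h]
      exact sub_mem (hR n x v hv) (sum_mem fun s _ => zsmul_mem (hdiv _ _ (ih _ (by omega))) _)
    have h2 := zsmul_mem h1 ((-1) ^ n)
    rwa [smul_smul, ← mul_pow, neg_one_mul, neg_neg, one_pow, one_smul] at h2

/-- Multiplication by arbitrary elements reduces to generators through the axioms: `mul_mul_eq`
expands compound left factors, and associativity expands compound right factors. -/
theorem isIdeal_of_operators (hD : ∀ v ∈ J, D k v ∈ J)
    (hL : ∀ (n : ℕ) (x : X), ∀ v ∈ J, mul k n (gen k N x) v ∈ J)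
    (hR : ∀ (n : ℕ) (x : X), ∀ v ∈ J, rOp k n (gen k N x) v ∈ J) : IsIdeal k J where
  D_mem := hD
  mul_mem_left n a b hb := mul_mem_of_gen_mul_mem hL a n b hb
  mul_mem_right n a b ha := by
    revert n a
    refine conf_induction k N (P := fun b => ∀ n a, a ∈ J → mul k n a b ∈ J)
      ?_ ?_ ?_ ?_ ?_ ?_ b
    · intro n a _; simp
    · intro b c hb hc n a ha
      rw [map_add]
      exact add_mem (hb n a ha) (hc n a ha)
    · intro c b hb n a ha
      rw [map_smul]
      exact Submodule.smul_mem _ _ (hb n a ha)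
    · exact fun x n a ha => mul_gen_mem_of_rOp_mem hD hR x ha n
    · intro b hb n a ha
      rw [conf_mul_D]
      exact add_mem (hD _ (hb n a ha)) (nsmul_mem (hb _ a ha) n)
    · intro m b c hb hc n a ha
      rw [conf_assoc]
      exact sum_mem fun s _ => nsmul_mem (hc _ _ (hb _ a ha)) _

end OperatorSubmodules

/-! ### Representing elements of `Conf k N` by words -/

section Represent

variable {k : Type v} [Field k] {X : Type u} {N : X → X → ℕ}

theorem represent_word (b : NormalWord N) :
    represent k (gen k N) (mono k b.word) = b.value k := represent_lWord _ _ _ _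

/-- The image in the quotient of a generator. -/
noncomputable def quotGen (S : Set (Conf k N)) (x : X) : IdealQuotient k S :=
  (ideal k S).mkQ (gen k N x)

theorem quotGen_locality (S : Set (Conf k N)) (a b : X) (n : ℕ) (hn : N a b ≤ n) :
    mul k n (quotGen S a) (quotGen S b) = 0 := by
  rw [quotGen, quotGen, mul_mk, gen_locality k N a b n hn, map_zero]

theorem wordValue_quotGen (S : Set (Conf k N)) (s : ℕ) (l : List (ℕ × X)) (c : X) :
    wordValue k (quotGen S) s l c = (ideal k S).mkQ (wordValue k (gen k N) s l c) := by
  induction s with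
  | zero =>
    induction l with
    | nil => rfl
    | cons p l ih =>
      change mul k p.1 (quotGen S p.2) (wordValue k (quotGen S) 0 l c) = _
      rw [ih]; rfl
  | succ s ih =>
    have h : wordValue k (quotGen S) (s + 1) l c = D k (wordValue k (quotGen S) s l c) :=
      Function.iterate_succ_apply' _ _ _
    have h' : wordValue k (gen k N) (s + 1) l c = D k (wordValue k (gen k N) s l c) :=
      Function.iterate_succ_apply' _ _ _
    rw [h, h', ih]; rfl

theorem represent_quot_word (S : Set (Conf k N)) (b : NormalWord N) :
    represent k (quotGen S) (mono k b.word) = (ideal k S).mkQ (b.value k) := by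
  rw [NormalWord.word, represent_lWord, wordValue_quotGen]; rfl

theorem action_normalForms (S : Set (Conf k N)) {p : FreeAlg k X} (hp : p ∈ normalForms k S) :
    action k (quotGen S) p = 0 := by
  obtain ⟨f, hf, rfl⟩ := hp
  have h0 : Finsupp.linearCombination k
      (fun b : NormalWord N => (ideal k S).mkQ (b.value k)) f = 0 := by
    have h : (ideal k S).mkQ (Finsupp.linearCombination k (NormalWord.value k) f) = 0 :=
      (Submodule.Quotient.mk_eq_zero _).2 (subset_ideal k S hf)
    rw [Finsupp.linearCombination_apply, Finsupp.sum, map_sum] at h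
    simpa [Finsupp.linearCombination_apply, Finsupp.sum] using h
  refine LinearMap.ext fun q => ?_
  rw [Finsupp.linearCombination_apply, Finsupp.sum, map_sum, LinearMap.sum_apply]
  simp only [map_smul, LinearMap.smul_apply, NormalWord.word, action_lWord, wordValue_quotGen]
  rw [Finsupp.linearCombination_apply, Finsupp.sum] at h0
  ext1
  · simp [Prod.fst_sum]
  · simp only [Prod.snd_sum, Prod.smul_snd, smul_comm _ q.1]
    rw [← Finset.smul_sum]
    exact (congrArg (q.1 • ·) h0).trans (smul_zero _)

theorem represent_linearCombination_word {ι : Type*} (b : ι → NormalWord N) (f : ι →₀ k) :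
    represent k (gen k N) (Finsupp.linearCombination k (fun i => mono k (b i).word) f) =
      Finsupp.linearCombination k (fun i => (b i).value k) f := by
  simp [Finsupp.linearCombination_apply, Finsupp.sum, represent_word]

theorem represent_quot_linearCombination_word (S : Set (Conf k N)) {ι : Type*}
    (b : ι → NormalWord N) (f : ι →₀ k) :
    represent k (quotGen S) (Finsupp.linearCombination k (fun i => mono k (b i).word) f) =
      Finsupp.linearCombination k (fun i => (ideal k S).mkQ ((b i).value k)) f := by
  simp [Finsupp.linearCombination_apply, Finsupp.sum, represent_quot_word]

theorem normalForms_empty : normalForms k (∅ : Set (Conf k N)) = ∅ := by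
  ext p; simp [normalForms]

variable {C : Type w} [AddCommGroup C] [Module k C] [ConformalOps k C] [IsAssocConformal k C]
  {g : X → C}

theorem action_relSet [CharZero k] (hg : ∀ (a b : X) (n : ℕ), N a b ≤ n → mul k n (g a) (g b) = 0)
    {p : FreeAlg k X} (hp : p ∈ relSet k N) : action k g p = 0 := by
  rcases hp with (hp | hp) | hp
  exacts [action_freeRel g hg hp, action_algRel g hp, action_nullExt g hp]

theorem action_eq_zero_of_mem [CharZero k] {S : Set (Conf k N)} {t : FreeAlg k X}
    (ht : t ∈ normalForms k S ∪ relSet k N) : action k (quotGen S) t = 0 := by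
  rcases ht with ht | ht
  exacts [action_normalForms S ht, action_relSet (quotGen_locality S) ht]

theorem action_eq_zero_of_mem_multSpan [LinearOrder X] {T : Set (FreeAlg k X)}
    (hT : ∀ t ∈ T, action k g t = 0) {P : Word X → Prop} {f : FreeAlg k X}
    (hf : f ∈ multSpan T P) : action k g f = 0 := by
  induction hf using Submodule.span_induction with
  | mem x hx =>
    obtain ⟨s, hs, l, u, v, -, -, rfl⟩ := hx
    rw [map_mul, map_mul, hT s hs, mul_zero, zero_mul]
  | zero => exact map_zero _
  | add x y _ _ hx hy => rw [map_add, hx, hy, add_zero]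
  | smul c x _ hx => rw [map_smul, hx, smul_zero]

theorem represent_eq_zero {f : FreeAlg k X} (h : action k g f = 0) : represent k g f = 0 := by
  rw [represent_apply, h]; rfl

/-- The span of the words `u x` with `u` a word in `O` and `x ∈ X`. -/
noncomputable def moduleSpan (k : Type v) [Field k] (X : Type u) : Submodule k (FreeAlg k X) :=
  wordSpan k fun w => ∃ (p : List (Op X)) (x : X), w = p.map Sum.inl ++ [Sum.inr x]

theorem op_mul_mem_moduleSpan (o : Op X) {f : FreeAlg k X} (hf : f ∈ moduleSpan k X) :
    mono k [.inl o] * f ∈ moduleSpan k X := by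
  have h := mul_mem_wordSpan (Q := fun w : Word X => ∃ (p : List (Op X)) (x : X),
    w = p.map Sum.inl ++ [Sum.inr x]) [.inl o] [] (by
      rintro w ⟨p, x, rfl⟩
      exact ⟨o :: p, x, by simp⟩) hf
  rwa [mono_nil, mul_one] at h

theorem word_mem_moduleSpan (b : NormalWord N) : mono k b.word ∈ moduleSpan k X := by
  refine mono_mem_wordSpan ⟨List.replicate b.s .d ++ b.l.map (fun p => .L p.1 p.2), b.c, ?_⟩
  simp [NormalWord.word, lWord]

/-- The image is stable under the operators and contains the generators. Closure under products
needs only the right factor in the image, by `mul_mem_of_gen_mul_mem`. -/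
theorem exists_represent (a : Conf k N) :
    a ∈ (moduleSpan k X).map (represent k (gen k N)) := by
  have hop : ∀ (o : Op X), ∀ v ∈ (moduleSpan k X).map (represent k (gen k N)),
      opEnd k (gen k N) o v ∈ (moduleSpan k X).map (represent k (gen k N)) := by
    rintro o _ ⟨f, hf, rfl⟩
    exact ⟨_, op_mul_mem_moduleSpan o hf, represent_op_mul _ o f⟩
  refine conf_induction k N (P := (· ∈ (moduleSpan k X).map (represent k (gen k N))))
    (zero_mem _) (fun _ _ => add_mem) (fun c _ => Submodule.smul_mem _ c) (fun x => ?_)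
    (fun v => hop .d v) (fun n a b _ hb => mul_mem_of_gen_mul_mem
      (fun n x => hop (.L n x)) a n b hb) a
  exact ⟨_, word_mem_moduleSpan (N := N) ⟨0, [], x, trivial⟩, represent_word (N := N) _⟩

end Represent

/-! ### Reduction modulo the relations -/

section ReductionModulo

variable {k : Type v} [Field k] {X : Type u} [LinearOrder X] {N : X → X → ℕ}
  {S : Set (Conf k N)}

theorem isConfGSB_iff : IsConfGSB k S ↔ IsGSB (normalForms k S ∪ relSet k N) := by
  rw [IsConfGSB, IsModuleGSB, relSet, ← Set.union_assoc, ← Set.union_assoc]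

theorem exists_word_of_mem_normalForms {p : FreeAlg k X} (hp : p ∈ normalForms k S)
    (hm : IsMonic p) : ∃ b : NormalWord N, p - mono k b.word ∈ lowSpan k b.word := by
  obtain ⟨f, -, rfl⟩ := hp
  have hw : ∀ w, (Finsupp.linearCombination k (fun b : NormalWord N => mono k b.word) f).coeff
      (FreeMonoid.ofList w) ≠ 0 → ∃ b : NormalWord N, w = b.word := by
    intro w hw
    by_contra h
    refine hw (coeff_of_mem_wordSpan (P := fun w => ∃ b : NormalWord N, w = b.word) ?_ h)
    rw [Finsupp.linearCombination_apply]
    exact Submodule.sum_mem _ fun b _ => Submodule.smul_mem _ _ (mono_mem_wordSpan ⟨b, rfl⟩)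
  obtain ⟨l, hl, -⟩ := id hm
  obtain ⟨b, rfl⟩ := hw l hl.1
  refine ⟨b, wordSpan_mono (fun w h => ⟨h.2, ?_⟩) (hm.sub_mem hl)⟩
  obtain ⟨b', rfl⟩ := hw w h.1
  rw [NormalWord.word, NormalWord.word, genDegree_lWord, genDegree_lWord]

theorem sub_mem_lowSpan (hS : ∀ p ∈ normalForms k S, IsMonic p) {t : FreeAlg k X}
    (ht : t ∈ normalForms k S ∪ relSet k N) {l : Word X} (hl : IsLeading t l) :
    t - mono k l ∈ lowSpan k l := by
  obtain ⟨l', h⟩ : ∃ l', t - mono k l' ∈ lowSpan k l' := by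
    rcases ht with ht | ht
    · obtain ⟨b, hb⟩ := exists_word_of_mem_normalForms ht (hS t ht)
      exact ⟨_, hb⟩
    · obtain ⟨l, -, hl⟩ := exists_relLead ht
      exact ⟨l, hl⟩
  obtain rfl := hl.unique (isLeading_of_sub_mem_lowSpan h)
  exact h

theorem isMonic_of_mem (hS : ∀ p ∈ normalForms k S, IsMonic p) {t : FreeAlg k X}
    (ht : t ∈ normalForms k S ∪ relSet k N) : IsMonic t := by
  rcases ht with ht | ht
  · exact hS t ht
  · obtain ⟨l, -, hl⟩ := exists_relLead ht
    exact isMonic_of_sub_mem_lowSpan hl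

/-- Preserving the number of letters from `X` keeps rewriting among words to which
`relLead_or_normal` applies. -/
theorem mul_sub_mem_lowSpan {t : FreeAlg k X} {l : Word X} (h : t - mono k l ∈ lowSpan k l)
    (u v : Word X) :
    mono k u * t * mono k v - mono k (u ++ l ++ v) ∈ lowSpan k (u ++ l ++ v) := by
  have := mul_mem_wordSpan (Q := fun w => wordLT w (u ++ l ++ v) ∧
    genDegree w = genDegree (u ++ l ++ v)) u v
    (fun q hq => ⟨wordLT_append u v hq.1, by simp only [genDegree_append, hq.2]⟩) h
  rwa [mul_sub, sub_mul, mono_mul_mono, mono_mul_mono] at this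

theorem multSpan_sup_mono {T : Set (FreeAlg k X)} {P Q : Word X → Prop} (h : ∀ w, P w → Q w)
    {K : Submodule k (FreeAlg k X)} {f : FreeAlg k X} (hf : f ∈ multSpan T P ⊔ K) :
    f ∈ multSpan T Q ⊔ K := by
  obtain ⟨x, hx, y, hy, rfl⟩ := Submodule.mem_sup.1 hf
  exact Submodule.add_mem_sup (multSpan_mono subset_rfl h hx) hy

/-- The span of the `S`-reduced normal words. -/
noncomputable def reducedSpan (S : Set (Conf k N)) : Submodule k (FreeAlg k X) :=
  Submodule.span k (Set.range fun b : {b : NormalWord N // IsReduced k S b} => mono k b.1.word)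

/-- Division with remainder, by well-founded induction on `w`. It asks nothing of compositions, and
its bound on principal words is what triviality of compositions refers to. -/
theorem mono_mem_sup [WellFoundedLT X] (hS : ∀ p ∈ normalForms k S, IsMonic p) (w : Word X)
    (hw : 1 ≤ genDegree w) :
    mono k w ∈ multSpan (normalForms k S ∪ relSet k N) (fun q => q = w ∨ wordLT q w) ⊔
      reducedSpan S := by
  revert hw
  refine wordLT_wellFounded.induction (C := fun w => 1 ≤ genDegree w → mono k w ∈
    multSpan (normalForms k S ∪ relSet k N) (fun q => q = w ∨ wordLT q w) ⊔ reducedSpan S)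
    w fun w ih hw => ?_
  have red : ∀ t ∈ normalForms k S ∪ relSet k N, ∀ l u v : Word X, IsLeading t l →
      w = u ++ l ++ v → mono k w ∈
        multSpan (normalForms k S ∪ relSet k N) (fun q => q = w ∨ wordLT q w) ⊔
          reducedSpan S := by
    intro t ht l u v hl e
    have h := mul_sub_mem_lowSpan (sub_mem_lowSpan hS ht hl) u v
    rw [← e] at h
    have h1 : mono k u * t * mono k v ∈ multSpan (normalForms k S ∪ relSet k N)
        (fun q => q = w ∨ wordLT q w) := mem_multSpan ht hl (.inl e.symm)
    have h2 : lowSpan k w ≤ multSpan (normalForms k S ∪ relSet k N)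
        (fun q => q = w ∨ wordLT q w) ⊔ reducedSpan S := by
      refine Submodule.span_le.2 ?_
      rintro _ ⟨q, ⟨hq, hq'⟩, rfl⟩
      refine multSpan_sup_mono ?_ (ih q hq (by omega))
      rintro q' (rfl | h)
      exacts [.inr hq, .inr (wordLT_trans h hq)]
    have h3 := sub_mem (Submodule.mem_sup_left h1) (h2 h)
    rwa [sub_sub_cancel] at h3
  rcases relLead_or_normal N w hw with ⟨l, u, v, hl, e⟩ | ⟨b, rfl⟩
  · obtain ⟨t, ht, htl⟩ := hl.exists_mem (k := k)
    exact red t (.inr ht) l u v (isLeading_of_sub_mem_lowSpan htl) e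
  · by_cases hb : IsReduced k S b
    · exact Submodule.mem_sup_right (Submodule.subset_span ⟨⟨b, hb⟩, rfl⟩)
    · simp only [IsReduced, not_forall, not_not] at hb
      obtain ⟨p, hp, l, u, v, hl, e⟩ := hb
      exact red p (.inl hp) l u v hl e

theorem lowSpan_le_sup [WellFoundedLT X] (hS : ∀ p ∈ normalForms k S, IsMonic p) {w : Word X}
    (hw : 1 ≤ genDegree w) :
    lowSpan k w ≤ multSpan (normalForms k S ∪ relSet k N) (wordLT · w) ⊔ reducedSpan S := by
  refine Submodule.span_le.2 ?_
  rintro _ ⟨q, ⟨hq, hq'⟩, rfl⟩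
  refine multSpan_sup_mono ?_ (mono_mem_sup hS q (by omega))
  rintro q' (rfl | h)
  exacts [hq, wordLT_trans h hq]

theorem moduleSpan_le_sup [WellFoundedLT X] (hS : ∀ p ∈ normalForms k S, IsMonic p) :
    moduleSpan k X ≤ multSpan (normalForms k S ∪ relSet k N) (fun _ => True) ⊔
      reducedSpan S := by
  refine Submodule.span_le.2 ?_
  rintro _ ⟨_, ⟨p, x, rfl⟩, rfl⟩
  exact multSpan_sup_mono (fun _ _ => trivial)
    (mono_mem_sup hS _ (by simp [genDegree]))

/-- The elements of `F(X)` representing zero are consequences of the relations. -/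
theorem mem_multSpan_of_represent_eq_zero [CharZero k] [WellFoundedLT X] {f : FreeAlg k X}
    (hf : f ∈ moduleSpan k X) (h0 : represent k (gen k N) f = 0) :
    f ∈ multSpan (relSet k N) fun _ => True := by
  -- With `S` empty the remainder is a combination of normal words; it represents zero in `Conf k
  -- N`, so their independence makes it vanish.
  have h := moduleSpan_le_sup (S := (∅ : Set (Conf k N))) (by simp [normalForms_empty]) hf
  rw [normalForms_empty, Set.empty_union] at h
  obtain ⟨j, hj, r, hr, rfl⟩ := Submodule.mem_sup.1 h
  obtain ⟨c, rfl⟩ := (Finsupp.mem_span_range_iff_exists_finsupp).1 hr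
  change j + Finsupp.linearCombination k _ c ∈ _
  change represent k (gen k N) (j + Finsupp.linearCombination k _ c) = 0 at h0
  rw [map_add, represent_eq_zero (action_eq_zero_of_mem_multSpan
    (fun t ht => action_relSet (gen_locality k N) ht) hj), zero_add,
    represent_linearCombination_word] at h0
  have hc : c = 0 := linearIndependent_iff.1
    ((linearIndependent_value k N).comp _ Subtype.val_injective) c h0
  rwa [hc, map_zero, add_zero]

/-- Every element of `Conf k N` is a linear combination of normal words. -/
theorem exists_linearCombination_value [CharZero k] [WellFoundedLT X] (a : Conf k N) :
    ∃ f : NormalWord N →₀ k, Finsupp.linearCombination k (NormalWord.value k) f = a := by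
  obtain ⟨f, hf, rfl⟩ := exists_represent a
  have h := moduleSpan_le_sup (S := (∅ : Set (Conf k N))) (by simp [normalForms_empty]) hf
  rw [normalForms_empty, Set.empty_union] at h
  obtain ⟨j, hj, r, hr, rfl⟩ := Submodule.mem_sup.1 h
  obtain ⟨c, rfl⟩ := (Finsupp.mem_span_range_iff_exists_finsupp).1 hr
  refine ⟨c.mapDomain Subtype.val, ?_⟩
  change _ = represent k (gen k N) (j + Finsupp.linearCombination k _ c)
  rw [map_add, represent_eq_zero (action_eq_zero_of_mem_multSpan
    (fun t ht => action_relSet (gen_locality k N) ht) hj), zero_add,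
    represent_linearCombination_word, Finsupp.linearCombination_mapDomain]
  rfl

end ReductionModulo

/-! ### Compositions of the relations of `A(X)` -/

section AlgCompositions

variable {k : Type v} [Field k] {X : Type u} [LinearOrder X]

theorem AlgRel.leading_eq {f : FreeAlg k X} {l : Word X} (hf : AlgRel f) (hl : IsLeading f l) :
    (∃ n a, l = [.inl (.L n a), .inl .d] ∧ f = mono k [.inl (.L n a), .inl .d] -
        mono k [.inl .d, .inl (.L n a)] - n • mono k [.inl (.L (n - 1) a)]) ∨
      (∃ n a, l = [.inl (.R n a), .inl .d] ∧ f = mono k [.inl (.R n a), .inl .d] -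
        mono k [.inl .d, .inl (.R n a)] - n • mono k [.inl (.R (n - 1) a)]) ∨
      ∃ n m a b, l = [.inl (.R m b), .inl (.L n a)] ∧ f = mono k [.inl (.R m b), .inl (.L n a)] -
        mono k [.inl (.L n a), .inl (.R m b)] := by
  cases hf with
  | L_d n a =>
    exact .inl ⟨n, a, hl.unique (isLeading_of_sub_mem_lowSpan (L_d_mem n a)), rfl⟩
  | R_d n a =>
    exact .inr (.inl ⟨n, a, hl.unique (isLeading_of_sub_mem_lowSpan (R_d_mem n a)), rfl⟩)
  | R_L n m a b =>
    exact .inr (.inr ⟨n, m, a, b, hl.unique (isLeading_of_sub_mem_lowSpan (R_L_mem n m a b)),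
      rfl⟩)

/-- The two ways of rewriting `R L ∂` meet because `L` and `R` satisfy the same commutation rule
with `∂`. The terms `h1`, …, `h6` are the rewriting steps used along both ways. -/
theorem R_L_d_trivial (n m : ℕ) (a b : X) :
    (mono k [.inl (.R m b), .inl (.L n a)] - mono k [.inl (.L n a), .inl (.R m b)]) *
        mono k [.inl .d] -
      mono k [.inl (.R m b)] * (mono k [.inl (.L n a), .inl .d] -
        mono k [.inl .d, .inl (.L n a)] - n • mono k [.inl (.L (n - 1) a)]) ∈
      multSpan {p : FreeAlg k X | AlgRel p}
        (wordLT · [.inl (.R m b), .inl (.L n a), .inl .d]) := by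
  let d : Letter X := .inl .d
  let L : ℕ → Letter X := fun n => .inl (.L n a)
  let R : ℕ → Letter X := fun m => .inl (.R m b)
  have h1 := mem_multSpan (P := (wordLT · [R m, L n, d])) (u := [L n]) (v := [])
    (AlgRel.R_d (k := k) m b) (isLeading_of_sub_mem_lowSpan (R_d_mem m b))
    (by simp [wordLT, genDegree, rDegree, letterLT, Op.lt, List.cons_lex_cons_iff, R, L, d])
  have h2 := mem_multSpan (P := (wordLT · [R m, L n, d])) (u := []) (v := [L n])
    (AlgRel.R_d (k := k) m b) (isLeading_of_sub_mem_lowSpan (R_d_mem m b))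
    (by simp [wordLT, genDegree, rDegree, letterLT, Op.lt, List.cons_lex_cons_iff, R, L, d])
  have h3 := mem_multSpan (P := (wordLT · [R m, L n, d])) (u := []) (v := [])
    (AlgRel.R_L (k := k) (n - 1) m a b) (isLeading_of_sub_mem_lowSpan (R_L_mem (n - 1) m a b))
    (by simp [wordLT, genDegree, rDegree, letterLT, Op.lt, List.cons_lex_cons_iff, R, L, d])
  have h4 := mem_multSpan (P := (wordLT · [R m, L n, d])) (u := [d]) (v := [])
    (AlgRel.R_L (k := k) n m a b) (isLeading_of_sub_mem_lowSpan (R_L_mem n m a b))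
    (by simp [wordLT, genDegree, rDegree, letterLT, Op.lt, List.cons_lex_cons_iff, R, L, d])
  have h5 := mem_multSpan (P := (wordLT · [R m, L n, d])) (u := []) (v := [])
    (AlgRel.R_L (k := k) n (m - 1) a b) (isLeading_of_sub_mem_lowSpan (R_L_mem n (m - 1) a b))
    (by simp [wordLT, genDegree, rDegree, letterLT, Op.lt, List.cons_lex_cons_iff, R, L, d])
  have h6 := mem_multSpan (P := (wordLT · [R m, L n, d])) (u := []) (v := [R m])
    (AlgRel.L_d (k := k) n a) (isLeading_of_sub_mem_lowSpan (L_d_mem n a))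
    (by simp [wordLT, genDegree, rDegree, letterLT, Op.lt, List.cons_lex_cons_iff, R, L, d])
  have h := add_mem (add_mem (add_mem (add_mem (add_mem (neg_mem h1) h2) (nsmul_mem h3 n)) h4)
    (nsmul_mem h5 m)) (neg_mem h6)
  refine (congrArg (· ∈ multSpan {p : FreeAlg k X | AlgRel p} (wordLT · [R m, L n, d])) ?_).mp h
  simp only [mul_sub, sub_mul, mul_smul_comm, smul_mul_assoc, mono_mul_mono, List.nil_append,
    List.cons_append, List.append_nil, smul_sub, L, R, d]
  abel

/-- The principal words are `L ∂`, `R ∂` and `R L`, all of length two. An inclusion thus compares a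
relation with itself, and only `L` is both a last and a first letter. -/
theorem algRel_composition_trivial {f g h : FreeAlg k X} {w : Word X} (hf : AlgRel f)
    (hg : AlgRel g) (hc : IsComposition f g w h) :
    h ∈ multSpan {p : FreeAlg k X | AlgRel p} (wordLT · w) := by
  cases hc with
  | inclusion lg u v hlf hlg =>
    have key : f = g ∧ u = [] ∧ v = [] := by
      have hlen : ∀ {f : FreeAlg k X} {l : Word X}, AlgRel f → IsLeading f l → l.length = 2 := by
        intro f l hf hl
        rcases hf.leading_eq hl with ⟨n, a, rfl, -⟩ | ⟨n, a, rfl, -⟩ | ⟨n, m, a, b, rfl, -⟩ <;> rfl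
      have h1 := hlen hf hlf
      have h2 := hlen hg hlg
      simp only [List.length_append] at h1
      have hu : u = [] := List.length_eq_zero_iff.1 (by omega)
      have hv : v = [] := List.length_eq_zero_iff.1 (by omega)
      subst hu hv
      refine ⟨?_, rfl, rfl⟩
      rw [List.nil_append, List.append_nil] at hlf
      rcases hf.leading_eq hlf with ⟨n, a, rfl, rfl⟩ | ⟨n, a, rfl, rfl⟩ | ⟨n, m, a, b, rfl, rfl⟩ <;>
      rcases hg.leading_eq hlg with ⟨n', a', h, rfl⟩ | ⟨n', a', h, rfl⟩ |
        ⟨n', m', a', b', h, rfl⟩ <;>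
      simp at h
      · obtain ⟨rfl, rfl⟩ := h; rfl
      · obtain ⟨rfl, rfl⟩ := h; rfl
      · obtain ⟨⟨rfl, rfl⟩, rfl, rfl⟩ := h; rfl
    obtain ⟨rfl, rfl, rfl⟩ := key
    rw [mono_nil, one_mul, mul_one, sub_self]
    exact zero_mem _
  | intersection u₁ u₂ v₂ h₁ h₂ h₃ hlf hlg =>
    have split : ∀ {p q : Word X} {y z : Letter X}, p ≠ [] → q ≠ [] → p ++ q = [y, z] →
        p = [y] ∧ q = [z] := by
      intro p q y z hp hq e
      rcases p with _ | ⟨y', _ | ⟨z', p⟩⟩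
      · exact absurd rfl hp
      · simpa using e
      · simp at e; exact absurd e.2.2.2 hq
    rcases hf.leading_eq hlf with ⟨n, a, e, rfl⟩ | ⟨n, a, e, rfl⟩ | ⟨n, m, a, b, e, rfl⟩ <;>
    rcases hg.leading_eq hlg with ⟨n', a', e', rfl⟩ | ⟨n', a', e', rfl⟩ |
      ⟨n', m', a', b', e', rfl⟩ <;>
    obtain ⟨rfl, rfl⟩ := split h₁ h₂ e <;>
    obtain ⟨e2, rfl⟩ := split h₂ h₃ e' <;>
    simp at e2
    obtain ⟨rfl, rfl⟩ := e2
    exact R_L_d_trivial n m a b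

variable {N : X → X → ℕ} {S : Set (Conf k N)}

/-- Relations whose principal word has no letter from `X` are relations of `A(X)`. -/
theorem algRel_of_genDegree_eq_zero (hS : ∀ p ∈ normalForms k S, IsMonic p) {t : FreeAlg k X}
    (ht : t ∈ normalForms k S ∪ relSet k N) {l : Word X} (hl : IsLeading t l)
    (h0 : genDegree l = 0) : AlgRel t := by
  rcases ht with ht | (ht | ht) | ⟨x, z, rfl⟩
  · obtain ⟨b, hb⟩ := exists_word_of_mem_normalForms ht (hS t ht)
    rw [hl.unique (isLeading_of_sub_mem_lowSpan hb), NormalWord.word, genDegree_lWord] at h0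
    exact absurd h0 one_ne_zero
  · exfalso
    cases ht with
    | locality a b n hn =>
      rw [hl.unique (isLeading_of_sub_mem_lowSpan (l := [.inl (.L n a), .inr b]) (by simp))] at h0
      simp [genDegree] at h0
    | right a b n =>
      rw [hl.unique (isLeading_of_sub_mem_lowSpan (right_mem a b n _))] at h0
      simp [genDegree] at h0
    | extended a b n m hn l c hl' =>
      rw [hl.unique (isLeading_of_sub_mem_lowSpan (extended_mem a b n m l c _)),
        genDegree_lWord] at h0
      exact absurd h0 one_ne_zero
  · exact ht
  · rw [hl.unique (isLeading_of_sub_mem_lowSpan (l := [.inr x, z]) (by simp))] at h0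
    simp [genDegree] at h0

theorem avoidsLeading_of_isReduced {b : NormalWord N} (hb : IsReduced k S b) :
    AvoidsLeading (normalForms k S ∪ relSet k N) b.word := by
  rintro t (ht | ht) l u v hl
  · exact hb t ht l u v hl
  · obtain ⟨l', hl', h⟩ := exists_relLead ht
    obtain rfl := hl.unique (isLeading_of_sub_mem_lowSpan h)
    exact hl'.not_normal u v b

end AlgCompositions

/-! ### The main theorem -/

section Main

variable {k : Type v} [Field k] [CharZero k] {X : Type u} [LinearOrder X] [WellFoundedLT X]
  {N : X → X → ℕ} {S : Set (Conf k N)}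

/-- Spanning needs rewriting only, so it holds whether or not compositions are trivial. -/
theorem span_reduced_eq_top (hS : ∀ p ∈ normalForms k S, IsMonic p) :
    Submodule.span k (Set.range (fun b : {b : NormalWord N // IsReduced k S b} =>
      (ideal k S).mkQ (b.1.value k))) = ⊤ := by
  refine eq_top_iff.2 fun a _ => ?_
  obtain ⟨a, rfl⟩ := (ideal k S).mkQ_surjective a
  obtain ⟨f, rfl⟩ := exists_linearCombination_value a
  have h : Finsupp.linearCombination k (fun b : NormalWord N => mono k b.word) f ∈
      moduleSpan k X := by
    rw [Finsupp.linearCombination_apply]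
    exact Submodule.sum_mem _ fun b _ => Submodule.smul_mem _ _ (word_mem_moduleSpan b)
  obtain ⟨j, hj, r, hr, e⟩ := Submodule.mem_sup.1 (moduleSpan_le_sup hS h)
  obtain ⟨c, rfl⟩ := (Finsupp.mem_span_range_iff_exists_finsupp).1 hr
  refine (Finsupp.mem_span_range_iff_exists_finsupp).2 ⟨c, ?_⟩
  have e' := congrArg (represent k (quotGen S)) e
  change represent k (quotGen S) (j + Finsupp.linearCombination k _ c) = _ at e'
  rw [map_add, represent_eq_zero (action_eq_zero_of_mem_multSpan
    (fun t ht => action_eq_zero_of_mem ht) hj), zero_add,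
    represent_quot_linearCombination_word] at e'
  refine Eq.trans (e'.trans (represent_quot_linearCombination_word S (fun b => b) f)) ?_
  rw [Finsupp.linearCombination_apply, Finsupp.linearCombination_apply, Finsupp.sum, Finsupp.sum,
    map_sum]
  rfl

/-- A composition is a combination of words below `w` that acts by zero on the quotient. Its
remainder therefore represents zero there, and independence leaves only multiples with principal
words below `w`. -/
theorem isGSB_of_linearIndependent (hS : ∀ p ∈ normalForms k S, IsMonic p)
    (hli : LinearIndependent k (fun b : {b : NormalWord N // IsReduced k S b} =>
      (ideal k S).mkQ (b.1.value k))) :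
    IsGSB (normalForms k S ∪ relSet k N) := by
  refine ⟨fun f hf => isMonic_of_mem hS hf, fun f hf g hg w h hc => isTrivialMod_iff.2 ?_⟩
  by_cases hw : 1 ≤ genDegree w
  · have h1 : h ∈ lowSpan k w ∧ action k (quotGen S) h = 0 := by
      cases hc with
      | inclusion lg u v hlf hlg =>
        have a := sub_mem_lowSpan hS hf hlf
        have b := mul_sub_mem_lowSpan (sub_mem_lowSpan hS hg hlg) u v
        refine ⟨by simpa using sub_mem a b, ?_⟩
        rw [map_sub, map_mul, map_mul, action_eq_zero_of_mem hf, action_eq_zero_of_mem hg]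
        simp
      | intersection u₁ u₂ v₂ h₁ h₂ h₃ hlf hlg =>
        have a := mul_sub_mem_lowSpan (sub_mem_lowSpan hS hf hlf) [] v₂
        have b := mul_sub_mem_lowSpan (sub_mem_lowSpan hS hg hlg) u₁ []
        simp only [mono_nil, one_mul, mul_one, List.nil_append, List.append_nil] at a b
        rw [← List.append_assoc] at b
        refine ⟨by simpa using sub_mem a b, ?_⟩
        rw [map_sub, map_mul, map_mul, action_eq_zero_of_mem hf, action_eq_zero_of_mem hg]
        simp
    obtain ⟨h1, h2⟩ := h1
    obtain ⟨j, hj, r, hr, rfl⟩ := Submodule.mem_sup.1 (lowSpan_le_sup hS hw h1)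
    obtain ⟨c, rfl⟩ := (Finsupp.mem_span_range_iff_exists_finsupp).1 hr
    have h3 := represent_eq_zero h2
    change represent k (quotGen S) (j + Finsupp.linearCombination k _ c) = 0 at h3
    rw [map_add, represent_eq_zero (action_eq_zero_of_mem_multSpan
      (fun t ht => action_eq_zero_of_mem ht) hj), zero_add,
      represent_quot_linearCombination_word] at h3
    have hc : c = 0 := linearIndependent_iff.1 hli c h3
    subst hc
    simpa using hj
  -- Words in `O` alone are outside the reach of normal words; here both elements must be relations
  -- of `A(X)`.
  · have h0 : genDegree w = 0 := by omega
    have key : AlgRel f ∧ AlgRel g := by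
      cases hc with
      | inclusion lg u v hlf hlg =>
        exact ⟨algRel_of_genDegree_eq_zero hS hf hlf h0,
          algRel_of_genDegree_eq_zero hS hg hlg (genDegree_eq_zero_of_append h0)⟩
      | intersection u₁ u₂ v₂ h₁ h₂ h₃ hlf hlg =>
        refine ⟨algRel_of_genDegree_eq_zero hS hf hlf
            (genDegree_eq_zero_of_append (u := []) (v := v₂) h0),
          algRel_of_genDegree_eq_zero hS hg hlg
            (genDegree_eq_zero_of_append (u := u₁) (v := []) ?_)⟩
        rwa [List.append_nil, ← List.append_assoc]
    exact multSpan_mono (fun p hp => .inr (.inl (.inr hp))) (fun _ hq => hq)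
      (algRel_composition_trivial key.1 key.2 hc)

/-- The elements of the ideal generated by `S` are represented by consequences of the relations
and the elements of `S`. -/
theorem ideal_le_map_represent (S : Set (Conf k N)) (hS : ∀ p ∈ normalForms k S, IsMonic p) :
    ideal k S ≤ (multSpan (normalForms k S ∪ relSet k N) (fun _ => True) ⊓ moduleSpan k X).map
      (represent k (gen k N)) := by
  have hop : ∀ (o : Op X), ∀ v ∈ (multSpan (normalForms k S ∪ relSet k N) (fun _ => True) ⊓
      moduleSpan k X).map (represent k (gen k N)), opEnd k (gen k N) o v ∈
        (multSpan (normalForms k S ∪ relSet k N) (fun _ => True) ⊓ moduleSpan k X).map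
          (represent k (gen k N)) := by
    rintro o _ ⟨f, ⟨hf, hf'⟩, rfl⟩
    refine ⟨_, ⟨?_, op_mul_mem_moduleSpan o hf'⟩, represent_op_mul _ o f⟩
    have h := mul_mem_multSpan (Q := fun _ => True) [.inl o] [] (fun _ _ => trivial) hf
    rwa [mono_nil, mul_one] at h
  -- The image is stable under `∂`, `L_n^a` and `R_n^a`, hence an ideal, and it remains to see that
  -- it contains `S`.
  refine ideal_le k (isIdeal_of_operators (hop .d) (fun n x => hop (.L n x))
    (fun n x => hop (.R n x))) fun a ha => ?_
  obtain ⟨f, rfl⟩ := exists_linearCombination_value a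
  have hp : Finsupp.linearCombination k (fun b : NormalWord N => mono k b.word) f ∈
      normalForms k S := ⟨f, ha, rfl⟩
  refine ⟨_, ⟨?_, ?_⟩, represent_linearCombination_word id f⟩
  · obtain ⟨b, hb⟩ := exists_word_of_mem_normalForms hp (hS _ hp)
    have h := mem_multSpan (P := fun _ => True) (u := []) (v := [])
      (T := normalForms k S ∪ relSet k N) (.inl hp) (isLeading_of_sub_mem_lowSpan hb) trivial
    rwa [mono_nil, one_mul, mul_one] at h
  · rw [Finsupp.linearCombination_apply]
    exact Submodule.sum_mem _ fun b _ => Submodule.smul_mem _ _ (word_mem_moduleSpan b)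

/-- A reduced combination representing an element of the ideal of `S` is shown to lie in the ideal
of `k⟨Z⟩` generated by the Gröbner–Shirshov basis, which contains no nonzero combination of
irreducible words. -/
theorem linearIndependent_of_isGSB (hS : ∀ p ∈ normalForms k S, IsMonic p)
    (hT : IsGSB (normalForms k S ∪ relSet k N)) :
    LinearIndependent k (fun b : {b : NormalWord N // IsReduced k S b} =>
      (ideal k S).mkQ (b.1.value k)) := by
  rw [linearIndependent_iff]
  intro c hc
  set z := Finsupp.linearCombination k
    (fun b : {b : NormalWord N // IsReduced k S b} => b.1.value k) c with hz
  set p := Finsupp.linearCombination k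
    (fun b : {b : NormalWord N // IsReduced k S b} => mono k b.1.word) c with hp
  have hpz : represent k (gen k N) p = z := represent_linearCombination_word _ c
  have hz0 : z ∈ ideal k S := by
    rw [← Submodule.Quotient.mk_eq_zero, ← Submodule.mkQ_apply, ← hc, hz,
      Finsupp.linearCombination_apply, Finsupp.linearCombination_apply, Finsupp.sum, Finsupp.sum,
      map_sum]
    rfl
  obtain ⟨q, ⟨hq, hq'⟩, e⟩ := ideal_le_map_represent S hS hz0
  have hpm : p ∈ moduleSpan k X := by
    rw [hp, Finsupp.linearCombination_apply]
    exact Submodule.sum_mem _ fun b _ => Submodule.smul_mem _ _ (word_mem_moduleSpan b.1)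
  -- The words `p` and the consequence `q` of `S` represent the same element of `Conf k N`, so they
  -- differ by a consequence of the relations without `S`.
  have h := mem_multSpan_of_represent_eq_zero (N := N) (sub_mem hpm hq')
    (by rw [map_sub, hpz, e, sub_self])
  have hpT : p ∈ multSpan (normalForms k S ∪ relSet k N) fun _ => True := by
    have h' := add_mem (multSpan_mono (T' := normalForms k S ∪ relSet k N)
      (fun _ ht => .inr ht) (fun _ hw => hw) h) hq
    rwa [sub_add_cancel] at h'
  have hp0 : p = 0 := by
    refine hT.eq_zero hpT fun w hw => ?_
    by_contra hne
    refine hw (coeff_of_mem_wordSpan (P := AvoidsLeading (normalForms k S ∪ relSet k N)) ?_ hne)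
    rw [hp, Finsupp.linearCombination_apply]
    exact Submodule.sum_mem _ fun b _ => Submodule.smul_mem _ _
      (mono_mem_wordSpan (avoidsLeading_of_isReduced b.2))
  rw [hp0, map_zero] at hpz
  exact linearIndependent_iff.1 ((linearIndependent_value k N).comp _ Subtype.val_injective) c
    hpz.symm

end Main

end ConfAlg

theorem mainTheorem1 {k : Type*} [Field k] [CharZero k] {X : Type*} [LinearOrder X]
    [WellFoundedLT X] (N : X → X → ℕ) (S : Set (ConfAlg.Conf k N))
    (hS : ∀ p ∈ ConfAlg.normalForms k S, ConfAlg.IsMonic p) :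
    ConfAlg.IsConfGSB k S ↔
      (LinearIndependent k (fun b : {b : ConfAlg.NormalWord N // ConfAlg.IsReduced k S b} =>
          (ConfAlg.ideal k S).mkQ (b.1.value k)) ∧
        Submodule.span k (Set.range
          (fun b : {b : ConfAlg.NormalWord N // ConfAlg.IsReduced k S b} =>
            (ConfAlg.ideal k S).mkQ (b.1.value k))) = ⊤) := by
  rw [ConfAlg.isConfGSB_iff]
  exact ⟨fun h => ⟨ConfAlg.linearIndependent_of_isGSB hS h, ConfAlg.span_reduced_eq_top hS⟩,
    fun h => ConfAlg.isGSB_of_linearIndependent hS h.1⟩
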